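/- Let $\mathbb{F}_q$ be a finite field with $q$ elements, $A=\mathbb{F}_q[T]$, $F=\mathbb{F}_q(T)$, and let $k$ be a finite field that is an $A$-algebra via a ring homomorphism $\gamma\colon A\to k$; in particular $\mathbb{F}_q\subseteq k$. Let $k\{\tau\}$ be the ring of twisted polynomials with $\tau c=c^q\tau$ for $c\in k$. Let $\phi\colon A\to k\{\tau\}$, $a\mapsto\phi_a$, be a Drinfeld module of rank $r\ge 1$ over $k$, that is, an $\mathbb{F}_q$-algebra homomorphism with $\phi_T=\gamma(T)+g_1\tau+\cdots+g_r\tau^r$ and $g_r\neq 0$. Let $\mathcal{E}=\mathrm{End}_k(\phi)$ be the centralizer of $\phi(A)$ in $k\{\tau\}$, which is an $A$-algebra via $\phi$. Put $\pi=\tau^{[k:\mathbb{F}_q]}\in\mathcal{E}$, let $F(\pi)$ be the subfield of the division algebra $F\otimes_A\mathcal{E}$ generated by $\pi$ over $F$, and assume that $[F(\pi):F]=r$. Then there is a unique tuple $(b_1,\dots,b_{r-1})$ of monic polynomials in $A$ with $b_1\mid b_2\mid\cdots\mid b_{r-1}$ and $$\mathcal{E}/A[\pi]\cong A/b_1A\times\cdots\times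 A/b_{r-1}A$$ as $A$-modules (the Frobenius index of $\phi$). Moreover, for every $1\le i\le r-1$: (1) there is a monic polynomial $f_i(x)\in A[x]$ of degree $i$ such that $f_i(\pi)\in b_i\mathcal{E}$; (2) if $g(x)\in A[x]$ is a monic polynomial of degree $i$ and $b\in A$ is such that $g(\pi)\in b\mathcal{E}$, then $b$ divides $b_i$. -/

import Mathlib

open Polynomial
open scoped TensorProduct

universe u v

/-- A copy of the field `L`, which remembers the subfield `Fq` and so carries the action of `ℕ`
by powers of the `q`-Frobenius `α ↦ α ^ q`, where `q = #Fq`. -/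
def FrobTwist (_Fq : Type u) (L : Type v) : Type v := L

namespace FrobTwist

variable (Fq : Type u) (L : Type v)

instance [Field L] : Field (FrobTwist Fq L) := inferInstanceAs (Field L)

/-- The identity map of `L`. -/
def of [Field L] : L ≃+* FrobTwist Fq L := RingEquiv.refl L

theorem add_pow_card_pow [Field Fq] [Finite Fq] [Field L] [Algebra Fq L] (n : ℕ) (x y : L) :
    (x + y) ^ (Nat.card Fq ^ n) = x ^ (Nat.card Fq ^ n) + y ^ (Nat.card Fq ^ n) := by
  have := Fintype.ofFinite Fq
  obtain ⟨p, _, m, hp, hq⟩ := FiniteField.card' Fq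
  have : CharP L p := charP_of_injective_algebraMap' Fq p
  have : Fact p.Prime := ⟨hp⟩
  rw [Nat.card_eq_fintype_card, hq, ← pow_mul, add_pow_char_pow]

/-- The number `n` acts on `L` by the `n`-th power of the `q`-Frobenius: `n • α = α ^ (q ^ n)`. -/
noncomputable instance [Field Fq] [Finite Fq] [Field L] [Algebra Fq L] :
    MulSemiringAction (Multiplicative ℕ) (FrobTwist Fq L) where
  smul n x := x ^ (Nat.card Fq ^ n.toAdd)
  one_smul x := by
    change x ^ (Nat.card Fq ^ 0) = x
    rw [pow_zero, pow_one]
  mul_smul m n x := by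
    change x ^ (Nat.card Fq ^ (m.toAdd + n.toAdd)) =
      (x ^ (Nat.card Fq ^ n.toAdd)) ^ (Nat.card Fq ^ m.toAdd)
    rw [← pow_mul, pow_add, mul_comm]
  smul_zero n := zero_pow (pow_ne_zero _ Nat.card_pos.ne')
  smul_add n x y := add_pow_card_pow Fq L n.toAdd x y
  smul_one n := one_pow _
  smul_mul n x y := mul_pow x y _

theorem smul_def [Field Fq] [Finite Fq] [Field L] [Algebra Fq L]
    (n : Multiplicative ℕ) (x : FrobTwist Fq L) : n • x = x ^ (Nat.card Fq ^ n.toAdd) := rfl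

end FrobTwist

/-- The ring `L{τ}` of twisted polynomials in `τ` with coefficients in `L` written on the left and
the commutation rule `τ c = c ^ q τ`, where `q = #Fq`.
In `SkewPolynomial R` the variable `X` satisfies `X a = φ(a) X`, where `φ(a) = 1 • a`. -/
abbrev TwistedPolynomial (Fq : Type u) (L : Type v) [Field Fq] [Finite Fq] [Field L] [Algebra Fq L] :=
  SkewPolynomial (FrobTwist Fq L)

namespace TwistedPolynomial

variable (Fq : Type u) (L : Type v) [Field Fq] [Finite Fq] [Field L] [Algebra Fq L]

/-- The variable `τ` of `L{τ}`. -/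
noncomputable def tau : TwistedPolynomial Fq L := SkewPolynomial.X

/-- The inclusion of the constants, `L → L{τ}`. -/
noncomputable def const : L →+* TwistedPolynomial Fq L :=
  SkewPolynomial.CRingHom.comp (FrobTwist.of Fq L : L →+* FrobTwist Fq L)

/-- The coefficient of `τ ^ n`. -/
def coeff {Fq : Type u} {L : Type v} [Field Fq] [Finite Fq] [Field L] [Algebra Fq L]
    (f : TwistedPolynomial Fq L) (n : ℕ) : L :=
  (FrobTwist.of Fq L).symm (SkewPolynomial.coeff f n)

theorem tau_mul_const (c : L) : tau Fq L * const Fq L c = const Fq L (c ^ Nat.card Fq) * tau Fq L := by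
  change SkewPolynomial.X * SkewPolynomial.monomial 0 (FrobTwist.of Fq L c) =
    SkewPolynomial.monomial 0 (FrobTwist.of Fq L (c ^ Nat.card Fq)) * SkewPolynomial.X
  rw [SkewPolynomial.X_mul_monomial, SkewPolynomial.monomial_mul_X,
    MulSemiringAction.toRingHom_apply, FrobTwist.smul_def, toAdd_ofAdd, pow_one,
    map_pow (FrobTwist.of Fq L)]

/-- If `c ^ (q ^ n) = c` for all `c ∈ L`, then `τ ^ n` is central in `L{τ}`. -/
theorem tau_pow_mul {n : ℕ} (h : ∀ c : L, c ^ (Nat.card Fq ^ n) = c) (f : TwistedPolynomial Fq L) :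
    tau Fq L ^ n * f = f * tau Fq L ^ n := by
  have hφ : (fun (a : ℕ) (b : FrobTwist Fq L) ↦ SkewPolynomial.monomial a (SkewPolynomial.φ^[n] b)) =
      fun (a : ℕ) (b : FrobTwist Fq L) ↦ SkewPolynomial.monomial a b := by
    funext a b
    rw [SkewPolynomial.φ_iterate_apply, FrobTwist.smul_def]
    exact congrArg _ (h b)
  rw [tau, SkewPolynomial.X_pow_mul, hφ, SkewPolynomial.sum_monomial]

end TwistedPolynomial

/-- Let `A = Fq[T]` (the variable `T` is `Polynomial.X`), and let `γ : A → L` be an `A`-field.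
A Drinfeld module of rank `r ≥ 1` over `L` is a ring homomorphism `φ : A → L{τ}`, `a ↦ φ_a`,
which is the identity on the constants `Fq` and for which
`φ_T = γ(T) + g₁ τ + ⋯ + g_r τ ^ r` with `g_r ≠ 0`. -/
structure DrinfeldModule {Fq : Type u} {L : Type v} [Field Fq] [Finite Fq] [Field L] [Algebra Fq L]
    (γ : Fq[X] →ₐ[Fq] L) (r : ℕ) where
  /-- The map `a ↦ φ_a`. -/
  toRingHom : Fq[X] →+* TwistedPolynomial Fq L
  map_C : ∀ c : Fq, toRingHom (C c) = TwistedPolynomial.const Fq L (algebraMap Fq L c)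
  coeff_zero : (toRingHom X).coeff 0 = γ X
  coeff_rank : (toRingHom X).coeff r ≠ 0
  coeff_of_gt : ∀ n, r < n → (toRingHom X).coeff n = 0
  rank_pos : 1 ≤ r

namespace DrinfeldModule

section General

variable {Fq : Type u} {L : Type v} [Field Fq] [Finite Fq] [Field L] [Algebra Fq L]
  {γ : Fq[X] →ₐ[Fq] L} {r : ℕ} (φ : DrinfeldModule γ r)

/-- The endomorphism ring `End_L(φ)`: the centralizer of `φ(A)` in `L{τ}`. -/
noncomputable def endRing : Subring (TwistedPolynomial Fq L) :=
  Subring.centralizer (Set.range φ.toRingHom)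

theorem const_mul (c : Fq) (u : TwistedPolynomial Fq L) :
    TwistedPolynomial.const Fq L (algebraMap Fq L c) * u =
      u * TwistedPolynomial.const Fq L (algebraMap Fq L c) := by
  have := Fintype.ofFinite Fq
  induction u using SkewPolynomial.induction with
  | h0 => rw [mul_zero, zero_mul]
  | ha n a q _ _ ih =>
    rw [mul_add, add_mul, ih]
    congr 1
    change SkewPolynomial.C (FrobTwist.of Fq L (algebraMap Fq L c)) * SkewPolynomial.monomial n a =
      SkewPolynomial.monomial n a * SkewPolynomial.C (FrobTwist.of Fq L (algebraMap Fq L c))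
    rw [SkewPolynomial.C_mul_monomial, SkewPolynomial.monomial_mul_C,
      SkewPolynomial.φ_iterate_apply, FrobTwist.smul_def, mul_comm]
    congr 2
    rw [toAdd_ofAdd, ← map_pow, ← map_pow, Nat.card_eq_fintype_card, FiniteField.pow_card_pow]

/-- Equivalently, `End_L(φ) = {u ∈ L{τ} | u φ_T = φ_T u}`. -/
theorem mem_endRing_iff {u : TwistedPolynomial Fq L} :
    u ∈ φ.endRing ↔ u * φ.toRingHom X = φ.toRingHom X * u := by
  rw [endRing, Subring.mem_centralizer_iff]
  refine ⟨fun h ↦ (h _ ⟨X, rfl⟩).symm, ?_⟩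
  rintro h _ ⟨a, rfl⟩
  induction a using Polynomial.induction_on' with
  | add p q hp hq => rw [map_add, add_mul, mul_add, hp, hq]
  | monomial n c =>
    rw [← C_mul_X_pow_eq_monomial, map_mul, map_pow, φ.map_C]
    exact ((show Commute (TwistedPolynomial.const Fq L (algebraMap Fq L c)) u from
      const_mul c u).mul_left ((show Commute (φ.toRingHom X) u from h.symm).pow_left n)).eq

/-- `φ` as a homomorphism from `A` to `End_L(φ)`. -/
noncomputable def toEndRing : Fq[X] →+* φ.endRing :=
  φ.toRingHom.codRestrict φ.endRing fun a ↦ by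
    rw [endRing, Subring.mem_centralizer_iff]
    rintro _ ⟨b, rfl⟩
    rw [← map_mul, ← map_mul, mul_comm]

/-- `End_L(φ)` is an `A`-algebra through `φ`: the scalar `a` acts as multiplication by `φ_a`. -/
noncomputable instance : Algebra Fq[X] φ.endRing :=
  φ.toEndRing.toAlgebra' fun a u ↦
    Subtype.ext (Subring.mem_centralizer_iff.mp u.2 (φ.toRingHom a) ⟨a, rfl⟩)

/-- The endomorphism algebra `D = F ⊗_A End_L(φ)`, where `F = Fq(T)`. -/
abbrev endAlgebra : Type (max u v) := RatFunc Fq ⊗[Fq[X]] φ.endRing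

end General

section Finite

variable {Fq : Type u} {k : Type v} [Field Fq] [Finite Fq] [Field k] [Finite k] [Algebra Fq k]
  {γ : Fq[X] →ₐ[Fq] k} {r : ℕ} (φ : DrinfeldModule γ r)

/-- The Frobenius endomorphism `π = τ ^ [k : Fq]` of `φ`. -/
noncomputable def frob : φ.endRing :=
  ⟨TwistedPolynomial.tau Fq k ^ Module.finrank Fq k, by
    rw [mem_endRing_iff]
    refine TwistedPolynomial.tau_pow_mul Fq k (fun c ↦ ?_) _
    have := Fintype.ofFinite k
    rw [← Module.natCard_eq_pow_finrank, Nat.card_eq_fintype_card, FiniteField.pow_card]⟩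

/-- The subfield `K = F(π)` of `D`, as an `F`-subalgebra. (The element `π` is algebraic over `F` and
`D` is a division algebra, so that `F(π) = F[π]`.) -/
noncomputable def frobField : Subalgebra (RatFunc Fq) φ.endAlgebra :=
  Algebra.adjoin (RatFunc Fq) {1 ⊗ₜ[Fq[X]] φ.frob}

/-- The subring `A[π]` of `End_k(φ)`, as an `A`-subalgebra. -/
noncomputable def frobOrder : Subalgebra Fq[X] φ.endRing :=
  Algebra.adjoin Fq[X] {φ.frob}

/-- The tuple `(b₁, …, b_{r-1})` is the Frobenius index of `φ`: the `b_i` are monic,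
`b₁ ∣ b₂ ∣ ⋯ ∣ b_{r-1}`, and `End_k(φ) / A[π] ≅ A/b₁A × ⋯ × A/b_{r-1}A` as `A`-modules.
The entry `b_i` of the tuple is `b ⟨i - 1, _⟩`. -/
structure IsFrobeniusIndex (b : Fin (r - 1) → Fq[X]) : Prop where
  monic : ∀ i, (b i).Monic
  dvd : ∀ i j, i ≤ j → b i ∣ b j
  equiv : Nonempty ((φ.endRing ⧸ Subalgebra.toSubmodule φ.frobOrder) ≃ₗ[Fq[X]]
    ((i : Fin (r - 1)) → Fq[X] ⧸ Ideal.span {b i}))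

end Finite

end DrinfeldModule

/-! Write n = [k : F_q] and let E be the endomorphism ring. Since [F(π) : F] = r, the powers 1, π,
…, π^(r-1) are independent over A. The theorem follows once E is known to be a lattice over A of
rank exactly r, so that these powers span a sublattice of full rank.

Rank bound (`DrinfeldModule.finrank_endRing_le`). Left multiplication through φ makes k{τ} an
A-module of rank at most rn. Consider the operators x ↦ u x s on it, with u in an A-basis of E and s
among the n² elements α_j τ^i (i < n). They are independent over A
(`TwistedPolynomial.eq_zero_of_sum_mul_mul_monomial`) and commute with π. An operator commuting with
π is determined by its values at some m ≤ n elements (`exists_determining_family`), so the operators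
embed in a module of rank at most n · rn. Hence rank(E) · n² ≤ r n².

Existence (`exists_triangular_basis`). Filter E by the highest power of π that occurs in an element,
and let w_i be an element of the i-th step whose leading coefficient generates the ideal of all
leading coefficients there. That coefficient is 1/d_i up to a common denominator. Multiplication by
π moves each step to the next and keeps leading coefficients, which gives d_i ∣ d_{i+1} and, by
induction, d_i w_i = f_i(π) with f_i monic of degree i. So A[π] has basis d_i w_i, the quotient is ∏
A/d_i, and d_0 is a unit because d_0 w_0 = 1. Minimality of the leading coefficient of w_i gives
(2).

Uniqueness (`dvd_of_surjective_pi_quotient`) is that of invariant factors, by comparing ranks of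
free modules over a quotient of A. -/

/-! ### Triangular bases of lattices over a principal ideal domain. -/

section Lattice

variable {A M : Type*} [CommRing A] [AddCommGroup M] [Module A M]

/-- The families `v i` and `d i • b i` differ by a unitriangular change, so they have the same span.
This is what turns the triangular basis into a description of the quotient by A[π]. -/
theorem mem_span_iff_of_triangular {r : ℕ} {v : ℕ → M} (b : Module.Basis (Fin r) A M) (d : ℕ → A)
    (h : ∀ i : Fin r, d i • b i - v i ∈ Submodule.span A (v '' Set.Iio (i : ℕ))) (u : M) :
    u ∈ Submodule.span A (Set.range fun i : Fin r ↦ v i) ↔ ∀ i : Fin r, d i ∣ b.repr u i := by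
  constructor
  · have key : ∀ i : ℕ, ∀ hi : i < r, v i ∈ Submodule.span A (Set.range fun i : Fin r ↦ d i • b i) := by
      intro i
      induction i using Nat.strong_induction_on with
      | _ i ih =>
        intro hi
        have h1 := (Submodule.span_le (p := Submodule.span A (Set.range fun i : Fin r ↦ d i • b i))
          (s := v '' Set.Iio i)).mpr (by
            rintro _ ⟨j, hj, rfl⟩
            exact ih j hj (lt_trans (Set.mem_Iio.mp hj) hi)) (h ⟨i, hi⟩)
        have h2 : d i • b ⟨i, hi⟩ ∈ Submodule.span A (Set.range fun i : Fin r ↦ d i • b i) :=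
          Submodule.subset_span ⟨⟨i, hi⟩, rfl⟩
        simpa using sub_mem h2 h1
    intro hu
    have hu' : u ∈ Submodule.span A (Set.range fun i : Fin r ↦ d i • b i) := by
      refine Submodule.span_le.mpr ?_ hu
      rintro _ ⟨i, rfl⟩
      exact key i i.2
    clear hu
    induction hu' using Submodule.span_induction with
    | mem x hx =>
      obtain ⟨j, rfl⟩ := hx
      intro i
      rw [map_smul, Module.Basis.repr_self, Finsupp.smul_single, Finsupp.single_apply]
      split_ifs with hij
      · subst hij; simp
      · simp
    | zero => simp
    | add x y _ _ hx hy => intro i; rw [map_add]; exact dvd_add (hx i) (hy i)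
    | smul a x _ hx => intro i; rw [map_smul]; exact (hx i).mul_left a
  · intro hu
    rw [← b.sum_repr u]
    refine sum_mem fun i _ ↦ ?_
    obtain ⟨t, ht⟩ := hu i
    rw [ht, mul_comm, mul_smul]
    refine Submodule.smul_mem _ _ ?_
    rw [← sub_add_cancel (d i • b i) (v i)]
    refine add_mem (Submodule.span_mono ?_ (h i)) (Submodule.subset_span ⟨i, rfl⟩)
    rintro _ ⟨j, hj, rfl⟩
    exact ⟨⟨j, lt_trans (Set.mem_Iio.mp hj) i.2⟩, rfl⟩

/-- The elements whose coordinates with index at least `i` vanish. -/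
def coordFlag (c : ℕ → M →ₗ[A] A) (i : ℕ) : Submodule A M where
  carrier := {u | ∀ j, i ≤ j → c j u = 0}
  zero_mem' j _ := map_zero _
  add_mem' hu hw j hj := by rw [map_add, hu j hj, hw j hj, add_zero]
  smul_mem' a u hu j hj := by rw [map_smul, hu j hj, smul_zero]

/-- The i-th coordinates of this flag step form an ideal; a preimage of its generator will serve as
the i-th basis vector. -/
theorem exists_generator_coordFlag [IsPrincipalIdealRing A] (c : ℕ → M →ₗ[A] A) (i : ℕ) :
    ∃ w ∈ coordFlag c (i + 1), ∀ u ∈ coordFlag c (i + 1), c i w ∣ c i u := by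
  obtain ⟨e, he⟩ := IsPrincipalIdealRing.principal (Submodule.map (c i) (coordFlag c (i + 1)))
  have h1 : e ∈ Submodule.map (c i) (coordFlag c (i + 1)) := by
    rw [he]
    exact Submodule.mem_span_singleton_self e
  obtain ⟨w, hw, rfl⟩ := h1
  refine ⟨w, hw, fun u hu ↦ ?_⟩
  have h2 : c i u ∈ Submodule.map (c i) (coordFlag c (i + 1)) := ⟨u, hu, rfl⟩
  rw [he] at h2
  exact Ideal.mem_span_singleton.mp h2

variable [IsDomain A]

theorem exists_smul_mem_of_finite [Module.Finite A M] (N : Submodule A M)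
    (hN : ∀ u : M, ∃ a : A, a ≠ 0 ∧ a • u ∈ N) : ∃ ρ : A, ρ ≠ 0 ∧ ∀ u : M, ρ • u ∈ N := by
  have key : ∀ s : Finset M, ∃ ρ : A, ρ ≠ 0 ∧ ∀ u ∈ s, ρ • u ∈ N := by
    intro s
    classical
    induction s using Finset.induction with
    | empty => exact ⟨1, one_ne_zero, by simp⟩
    | insert x s _ ih =>
      obtain ⟨ρ, hρ, h⟩ := ih
      obtain ⟨a, ha, hx⟩ := hN x
      refine ⟨ρ * a, mul_ne_zero hρ ha, fun u hu ↦ ?_⟩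
      rcases Finset.mem_insert.mp hu with rfl | hu
      · rw [mul_smul]
        exact N.smul_mem _ hx
      · rw [mul_comm, mul_smul]
        exact N.smul_mem _ (h u hu)
  obtain ⟨s, hs⟩ := Module.Finite.fg_top (R := A) (M := M)
  obtain ⟨ρ, hρ, h⟩ := key s
  refine ⟨ρ, hρ, fun u ↦ ?_⟩
  have hu : u ∈ Submodule.span A (s : Set M) := hs ▸ Submodule.mem_top
  have hle : Submodule.span A (s : Set M) ≤ N.comap (LinearMap.lsmul A M ρ) :=
    Submodule.span_le.mpr fun x hx ↦ h x hx
  exact hle hu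

/-- Coordinates with a common denominator `ρ` with respect to a linearly independent family whose
span is of full rank. -/
theorem exists_coordinates [Module.Finite A M] {r : ℕ} {v : ℕ → M}
    (hv : LinearIndependent A fun i : Fin r ↦ v i)
    (htors : ∀ u : M, ∃ a : A, a ≠ 0 ∧ a • u ∈ Submodule.span A (Set.range fun i : Fin r ↦ v i)) :
    ∃ (ρ : A) (c : ℕ → M →ₗ[A] A), ρ ≠ 0 ∧ (∀ u, ρ • u = ∑ i ∈ Finset.range r, c i u • v i) ∧
      (∀ i, r ≤ i → c i = 0) ∧ ∀ i, ∀ j < r, c i (v j) = if i = j then ρ else 0 := by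
  obtain ⟨ρ, hρ, h⟩ := exists_smul_mem_of_finite _ htors
  let f : M →ₗ[A] Submodule.span A (Set.range fun i : Fin r ↦ v i) :=
    (LinearMap.lsmul A M ρ).codRestrict _ h
  let c : ℕ → M →ₗ[A] A := fun i ↦
    if hi : i < r then Finsupp.lapply (⟨i, hi⟩ : Fin r) ∘ₗ hv.repr ∘ₗ f else 0
  have hc : ∀ i : Fin r, ∀ u, c i u = hv.repr (f u) i := fun i u ↦ by simp [c]
  refine ⟨ρ, c, hρ, fun u ↦ ?_, fun i hi ↦ by simp [c, hi], fun i j hj ↦ ?_⟩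
  · have := hv.linearCombination_repr (f u)
    rw [Finset.sum_range]
    simp only [hc]
    rw [Finsupp.linearCombination_apply, Finsupp.sum_fintype _ _ (by simp)] at this
    exact this.symm
  · by_cases hi : i < r
    · have h1 : hv.repr (f (v j)) = Finsupp.single ⟨j, hj⟩ ρ := by
        apply hv.repr_eq
        rw [Finsupp.linearCombination_single]
        rfl
      have h2 := hc ⟨i, hi⟩ (v j)
      rw [h1, Finsupp.single_apply] at h2
      simpa [Fin.ext_iff, eq_comm] using h2
    · rw [if_neg (by omega)]
      simp [c, hi]

variable [IsPrincipalIdealRing A]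

/-- If `v 0, v 1 = P (v 0), …, v (r - 1)` span a sublattice of full rank of a lattice `M` over a
principal ideal domain, then `M` has a basis `b` which is triangular with respect to `v`:
`d i • b i = v i + ⋯` modulo the span of the `v j` with `j < i`, and `d 0 ∣ d 1 ∣ ⋯`. -/
theorem exists_triangular_basis [Module.Finite A M] [Module.IsTorsionFree A M] {r : ℕ} {v : ℕ → M}
    (P : M →ₗ[A] M) (hP : ∀ i, v (i + 1) = P (v i))
    (hv : LinearIndependent A fun i : Fin r ↦ v i)
    (htors : ∀ u : M, ∃ a : A, a ≠ 0 ∧ a • u ∈ Submodule.span A (Set.range fun i : Fin r ↦ v i)) :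
    ∃ (b : Module.Basis (Fin r) A M) (d : ℕ → A),
      (∀ i < r, d i ≠ 0) ∧ (∀ i j, i ≤ j → j < r → d i ∣ d j) ∧
      (∀ i : Fin r, d i • b i - v i ∈ Submodule.span A (v '' Set.Iio (i : ℕ))) ∧
      ∀ i : Fin r, ∀ (a : A) (u : M),
        a • u - v i ∈ Submodule.span A (v '' Set.Iio (i : ℕ)) → a ∣ d i := by
  obtain ⟨ρ, c, hρ, hsum, hbig, hcv⟩ := exists_coordinates hv htors
  choose w hw hgen using exists_generator_coordFlag c
  have hvmem : ∀ i < r, v i ∈ coordFlag c (i + 1) := fun i hi j hj ↦ by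
    rw [hcv j i hi, if_neg (by omega)]
  -- `v i` lies in the flag step generated by `w i` and has leading coordinate ρ, so `c i (w i)`
  -- divides ρ; the quotient is `d i`.
  have hd : ∀ i, ∃ d, i < r → ρ = c i (w i) * d := fun i ↦ by
    by_cases hi : i < r
    · obtain ⟨d, h⟩ := hgen i _ (hvmem i hi)
      rw [hcv i i hi, if_pos rfl] at h
      exact ⟨d, fun _ ↦ h⟩
    · exact ⟨0, fun h ↦ absurd h hi⟩
  choose d hd using hd
  have hspanv : ∀ i ≤ r, Submodule.span A (v '' Set.Iio i) ≤ coordFlag c i := by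
    intro i hi
    rw [Submodule.span_le]
    rintro _ ⟨j, hj, rfl⟩ l hl
    have hj : j < i := hj
    rw [hcv l j (by omega), if_neg (by omega)]
  have he : ∀ i < r, c i (w i) ≠ 0 := fun i hi h ↦ hρ (by rw [hd i hi, h, zero_mul])
  have hd0 : ∀ i < r, d i ≠ 0 := fun i hi h ↦ hρ (by rw [hd i hi, h, mul_zero])
  have hzero : ∀ u ∈ coordFlag c 0, u = 0 := fun u hu ↦ by
    have h := hsum u
    rw [Finset.sum_eq_zero fun i _ ↦ by rw [hu i (Nat.zero_le _), zero_smul]] at h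
    exact (smul_eq_zero.mp h).resolve_left hρ
  -- Elimination from the top coordinate down.
  have hspan : ∀ i, ∀ u ∈ coordFlag c i, ∃ a : ℕ → A, u = ∑ j ∈ Finset.range i, a j • w j := by
    intro i
    induction i with
    | zero => exact fun u hu ↦ ⟨0, by simp [hzero u hu]⟩
    | succ i ih =>
      intro u hu
      obtain ⟨t, ht⟩ := hgen i u hu
      have h : u - t • w i ∈ coordFlag c i := fun j hj ↦ by
        rcases hj.eq_or_lt with rfl | hj
        · rw [map_sub, map_smul, ht, smul_eq_mul, mul_comm, sub_self]
        · rw [map_sub, map_smul, hu j hj, hw i j hj, smul_zero, sub_zero]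
      obtain ⟨a, ha⟩ := ih _ h
      refine ⟨Function.update a i t, ?_⟩
      rw [Finset.sum_range_succ, Function.update_self, ← sub_eq_iff_eq_add, ha]
      refine Finset.sum_congr rfl fun j hj ↦ ?_
      rw [Function.update_of_ne (Finset.mem_range.mp hj).ne]
  -- `P` shifts coordinates by one place, as long as the shifted index stays below r.
  have hPc : ∀ i, i + 1 < r → ∀ u ∈ coordFlag c (i + 1),
      P u ∈ coordFlag c (i + 2) ∧ c (i + 1) (P u) = c i u := by
    intro i hi u hu
    have h1 : ρ • P u = ∑ j ∈ Finset.range (i + 1), c j u • v (j + 1) := by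
      rw [← map_smul, hsum, map_sum]
      simp only [map_smul, ← hP]
      refine (Finset.sum_subset (Finset.range_mono hi.le) fun j _ hj ↦ ?_).symm
      rw [hu j (by simpa using hj), zero_smul]
    have h2 : ∀ l, ρ * c l (P u) = ∑ j ∈ Finset.range (i + 1), c j u * (if l = j + 1 then ρ else 0) := by
      intro l
      rw [← smul_eq_mul, ← map_smul, h1, map_sum]
      refine Finset.sum_congr rfl fun j hj ↦ ?_
      rw [map_smul, smul_eq_mul, hcv l (j + 1) (by simp at hj; omega)]
    constructor
    · intro l hl
      have := h2 l
      rw [Finset.sum_eq_zero fun j hj ↦ by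
        rw [if_neg (by simp at hj; omega), mul_zero]] at this
      exact (mul_eq_zero.mp this).resolve_left hρ
    · have := h2 (i + 1)
      rw [Finset.sum_eq_single i (fun j _ hj ↦ by rw [if_neg (by omega), mul_zero])
        (fun h ↦ by simp at h), if_pos rfl, mul_comm (c i u)] at this
      exact mul_left_cancel₀ hρ this
  -- The leading coordinate of `P (w i)` equals `c i (w i)`, hence is a multiple m of `c (i + 1) (w
  -- (i + 1))`. As `c i (w i) * d i = ρ` for each index, m is also the ratio of consecutive `d`.
  have hstep : ∀ i, i + 1 < r → ∃ m, d (i + 1) = d i * m ∧ P (w i) - m • w (i + 1) ∈ coordFlag c (i + 1) := by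
    intro i hi
    obtain ⟨h1, h2⟩ := hPc i hi _ (hw i)
    obtain ⟨m, hm⟩ := hgen (i + 1) _ h1
    rw [h2] at hm
    refine ⟨m, ?_, fun j hj ↦ ?_⟩
    · have := (hd i (by omega)).symm.trans (hd (i + 1) hi)
      rw [hm, mul_assoc] at this
      rw [mul_comm, mul_left_cancel₀ (he (i + 1) hi) this]
    · rcases hj.eq_or_lt with rfl | hj
      · rw [map_sub, map_smul, h2, hm, smul_eq_mul, mul_comm, sub_self]
      · rw [map_sub, map_smul, h1 j hj, hw (i + 1) j hj, smul_zero, sub_zero]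
  have hdvd : ∀ i j, i ≤ j → j < r → d i ∣ d j := by
    intro i j hij
    induction j, hij using Nat.le_induction with
    | base => exact fun _ ↦ dvd_rfl
    | succ j hij ih =>
      intro hj
      obtain ⟨m, hm, _⟩ := hstep j hj
      exact (ih (by omega)).trans ⟨m, hm⟩
  have htri : ∀ i < r, d i • w i - v i ∈ Submodule.span A (v '' Set.Iio i) := by
    intro i
    induction i using Nat.strong_induction_on with
    | _ i ih =>
      intro hi
      rcases i with _ | i
      · have h : d 0 • w 0 - v 0 = 0 := by
          apply hzero
          intro j _
          rcases j with _ | j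
          · rw [map_sub, map_smul, hcv 0 0 hi, if_pos rfl, hd 0 hi, smul_eq_mul, mul_comm, sub_self]
          · rw [map_sub, map_smul, hcv _ 0 hi, hw 0 (j + 1) (by omega)]
            simp
        rw [h]
        exact zero_mem _
      · obtain ⟨m, hm, hz⟩ := hstep i hi
        obtain ⟨a, ha⟩ := hspan _ _ hz
        have hwmem : ∀ j ≤ i, d i • w j ∈ Submodule.span A (v '' Set.Iio (i + 1)) := by
          intro j hj
          obtain ⟨t, ht⟩ := hdvd j i hj (by omega)
          rw [ht, mul_comm, mul_smul]
          refine Submodule.smul_mem _ _ ?_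
          rw [← sub_add_cancel (d j • w j) (v j)]
          refine add_mem (Submodule.span_mono (Set.image_mono fun l hl ↦ ?_)
            (ih j (by omega) (by omega))) (Submodule.subset_span ⟨j, ?_, rfl⟩)
          · exact (Set.mem_Iio.mp hl).trans (by omega)
          · exact Set.mem_Iio.mpr (by omega)
        -- Apply `P` to the relation at i and correct by `d i` times the remainder from `hstep`. The
        -- remainder is a combination of `w j` with j ≤ i, and since `d j ∣ d i`, multiplying by `d
        -- i` brings it into the span of the `v`.
        have h1 : d (i + 1) • w (i + 1) - v (i + 1) =
            P (d i • w i - v i) - ∑ j ∈ Finset.range (i + 1), a j • d i • w j := by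
          have h2 : ∑ j ∈ Finset.range (i + 1), a j • d i • w j = d i • (P (w i) - m • w (i + 1)) := by
            rw [ha, Finset.smul_sum]
            exact Finset.sum_congr rfl fun j _ ↦ smul_comm _ _ _
          rw [h2, hm, map_sub, map_smul, ← hP, smul_sub, mul_smul]
          abel
        rw [h1]
        refine sub_mem ?_ (sum_mem fun j hj ↦ Submodule.smul_mem _ _ (hwmem j (by simp at hj; omega)))
        have h3 : Submodule.span A (v '' Set.Iio i) ≤
            (Submodule.span A (v '' Set.Iio (i + 1))).comap P := by
          rw [Submodule.span_le]
          rintro _ ⟨j, hj, rfl⟩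
          refine Submodule.subset_span ⟨j + 1, ?_, hP j⟩
          have : j < i := hj
          exact Set.mem_Iio.mpr (by omega)
        exact h3 (ih i (by omega) (by omega))
  have hindep : LinearIndependent A fun i : Fin r ↦ w i := by
    rw [Fintype.linearIndependent_iff]
    intro g hg
    have key : ∀ n ≤ r, ∀ a : ℕ → A, ∑ j ∈ Finset.range n, a j • w j = 0 → ∀ j < n, a j = 0 := by
      intro n
      induction n with
      | zero => exact fun _ _ _ j hj ↦ absurd hj (Nat.not_lt_zero j)
      | succ n ih =>
        intro hn a h
        have h1 : a n = 0 := by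
          have h2 := congrArg (c n) h
          rw [map_sum, map_zero, Finset.sum_range_succ, Finset.sum_eq_zero, zero_add, map_smul,
            smul_eq_mul] at h2
          · exact (mul_eq_zero.mp h2).resolve_right (he n hn)
          · intro j hj
            rw [map_smul, hw j n (by simp at hj; omega), smul_zero]
        rw [Finset.sum_range_succ, h1, zero_smul, add_zero] at h
        intro j hj
        rcases (Nat.lt_succ_iff.mp hj).eq_or_lt with rfl | hj
        · exact h1
        · exact ih (by omega) a h j hj
    have := key r le_rfl (fun j ↦ if hj : j < r then g ⟨j, hj⟩ else 0) (by
      rw [Finset.sum_range]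
      simpa using hg)
    intro i
    simpa using this i i.2
  have hfull : ⊤ ≤ Submodule.span A (Set.range fun i : Fin r ↦ w i) := by
    intro u _
    -- Coordinates with index at least r are zero by convention, so the r-th flag step is
    -- everything.
    have hu : u ∈ coordFlag c r := fun j hj ↦ by rw [hbig j hj, LinearMap.zero_apply]
    obtain ⟨a, ha⟩ := hspan r u hu
    rw [ha]
    exact sum_mem fun j hj ↦ Submodule.smul_mem _ _
      (Submodule.subset_span ⟨⟨j, Finset.mem_range.mp hj⟩, rfl⟩)
  refine ⟨Module.Basis.mk hindep hfull, d, hd0, hdvd, fun i ↦ ?_, fun i a u h ↦ ?_⟩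
  · rw [Module.Basis.mk_apply]
    exact htri i i.2
  -- Comparing coordinates gives `a * c i u = ρ` and puts u in the (i+1)-st flag step. So `c i (w
  -- i)` divides `c i u`, and cancelling it from ρ leaves `a ∣ d i`.
  · have hmem := hspanv i i.2.le h
    have hau : ∀ j, (i : ℕ) ≤ j → a * c j u = c j (v i) := fun j hj ↦ by
      have := hmem j hj
      rwa [map_sub, map_smul, sub_eq_zero] at this
    have h1 := hau i le_rfl
    rw [hcv i i i.2, if_pos rfl] at h1
    have ha : a ≠ 0 := fun h ↦ hρ (by rw [← h1, h, zero_mul])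
    have hu : u ∈ coordFlag c (i + 1) := fun j hj ↦ by
      have h2 := hau j (by omega)
      rw [hcv j i i.2, if_neg (by omega)] at h2
      exact (mul_eq_zero.mp h2).resolve_left ha
    obtain ⟨t, ht⟩ := hgen i u hu
    refine ⟨t, mul_left_cancel₀ (he i i.2) ?_⟩
    rw [← hd i i.2, ← h1, ht]
    ring

end Lattice

/-! ### Uniqueness of invariant factors. -/

/-- The uniqueness of invariant factors: if `b 0 ∣ b 1 ∣ ⋯` and `b' 0 ∣ b' 1 ∣ ⋯`, and
`∏ A / b i` is a quotient of `∏ A / b' i`, then `b j ∣ b' j` for all `j`. -/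
theorem dvd_of_surjective_pi_quotient {A : Type*} [CommRing A] {n : ℕ} {b b' : Fin n → A}
    (hb : ∀ i j, i ≤ j → b i ∣ b j) (hb' : ∀ i j, i ≤ j → b' i ∣ b' j)
    (ψ : ((i : Fin n) → A ⧸ Ideal.span {b' i}) →ₗ[A] ((i : Fin n) → A ⧸ Ideal.span {b i}))
    (hψ : Function.Surjective ψ) (j : Fin n) : b j ∣ b' j := by
  classical
  by_contra hj
  -- The colon ideal (b_j : b'_j), which is proper exactly when b_j does not divide b'_j.
  let I : Ideal A := Submodule.comap (LinearMap.lsmul A A (b' j)) (Ideal.span {b j})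
  have hI : ∀ {a}, a ∈ I ↔ b j ∣ b' j * a := fun {a} ↦ by
    rw [Submodule.mem_comap, LinearMap.lsmul_apply, smul_eq_mul, Ideal.mem_span_singleton]
  have : Nontrivial (A ⧸ I) := Ideal.Quotient.nontrivial_iff.mpr fun h ↦ hj (by
    have h1 : (1 : A) ∈ I := h ▸ Submodule.mem_top
    rwa [hI, mul_one] at h1)
  have hT : ∀ i l, ∃ t : A, Ideal.Quotient.mk (Ideal.span {b l}) t = ψ (Pi.single i 1) l :=
    fun i l ↦ Ideal.Quotient.mk_surjective _
  choose T hT using hT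
  -- For i ≤ j the element b'_j kills the i-th generator, so these matrix entries of `ψ` vanish
  -- modulo `I`.
  have hTI : ∀ i ≤ j, ∀ l, j ≤ l → b j ∣ b' j * T i l := by
    intro i hi l hl
    refine (hb j l hl).trans ?_
    rw [← Ideal.mem_span_singleton, ← Ideal.Quotient.eq_zero_iff_mem, map_mul, hT]
    have h : b' j • (Pi.single i 1 : (i : Fin n) → A ⧸ Ideal.span {b' i}) = 0 := by
      rw [← Pi.single_smul, Algebra.smul_def, mul_one]
      have : algebraMap A (A ⧸ Ideal.span {b' i}) (b' j) = 0 := by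
        rw [Ideal.Quotient.algebraMap_eq, Ideal.Quotient.eq_zero_iff_mem, Ideal.mem_span_singleton]
        exact hb' i j hi
      rw [this, Pi.single_zero]
    have h2 := congrFun (congrArg ψ h) l
    rw [map_smul, map_zero, Pi.smul_apply, Algebra.smul_def] at h2
    exact h2
  -- Modulo `I` only the generators with i > j contribute to the coordinates l ≥ j. So `f` would be
  -- a surjection onto a free module of larger rank over the nontrivial ring A/I.
  let f : ({i : Fin n // j < i} → A ⧸ I) →ₗ[A ⧸ I] ({l : Fin n // j ≤ l} → A ⧸ I) :=
    (Matrix.of fun (l : {l : Fin n // j ≤ l}) (i : {i : Fin n // j < i}) ↦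
      Ideal.Quotient.mk I (T i l)).mulVecLin
  have hf : Function.Surjective f := by
    intro z
    have hy : ∀ l, ∃ y : A, Ideal.Quotient.mk I y = z l := fun l ↦ Ideal.Quotient.mk_surjective _
    choose y hy using hy
    let Y : Fin n → A := fun l ↦ if hl : j ≤ l then y ⟨l, hl⟩ else 0
    obtain ⟨m, hm⟩ := hψ fun l ↦ Ideal.Quotient.mk _ (Y l)
    have ha : ∀ i, ∃ a : A, Ideal.Quotient.mk (Ideal.span {b' i}) a = m i :=
      fun i ↦ Ideal.Quotient.mk_surjective _
    choose a ha using ha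
    have hma : m = ∑ i, a i • (Pi.single i 1 : (i : Fin n) → A ⧸ Ideal.span {b' i}) := by
      funext l
      rw [Finset.sum_apply, Finset.sum_eq_single l]
      · rw [Pi.smul_apply, Pi.single_eq_same, Algebra.smul_def, mul_one, ← ha]
        rfl
      · intro i _ hi
        rw [Pi.smul_apply, Pi.single_eq_of_ne hi.symm, smul_zero]
      · simp
    refine ⟨fun i ↦ Ideal.Quotient.mk I (a i), funext fun l ↦ ?_⟩
    have h1 : b j ∣ ∑ i, a i * T i l - Y l := by
      refine (hb j l l.2).trans ?_
      rw [← Ideal.mem_span_singleton, ← Ideal.Quotient.eq_zero_iff_mem, map_sub, sub_eq_zero,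
        ← congrFun hm l, hma, map_sum, map_sum, Finset.sum_apply]
      refine Finset.sum_congr rfl fun i _ ↦ ?_
      rw [map_smul, Pi.smul_apply, ← hT, Algebra.smul_def, map_mul]
      rfl
    have h2 : Y l = y l := dif_pos l.2
    change ∑ i : {i : Fin n // j < i}, Ideal.Quotient.mk I (T i l) * Ideal.Quotient.mk I (a i) = z l
    rw [← hy, ← sub_eq_zero]
    simp only [← map_mul]
    rw [← map_sum, ← map_sub, Ideal.Quotient.eq_zero_iff_mem, hI, ← h2]
    have h3 : ∑ i, a i * T i l = ∑ i : {i : Fin n // j < i}, T i l * a i +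
        ∑ i : {i : Fin n // ¬ j < i}, T i l * a i := by
      rw [Fintype.sum_subtype_add_sum_subtype (fun i ↦ j < i) fun i ↦ T i l * a i]
      exact Finset.sum_congr rfl fun i _ ↦ mul_comm _ _
    have h4 : b j ∣ b' j * ∑ i : {i : Fin n // ¬ j < i}, T i l * a i := by
      rw [Finset.mul_sum]
      refine Finset.dvd_sum fun i _ ↦ ?_
      rw [← mul_assoc]
      exact (hTI i (not_lt.mp i.2) l l.2).mul_right _
    rw [h3] at h1
    have h5 := dvd_sub (h1.mul_left (b' j)) h4
    convert h5 using 1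
    ring
  have hcard := card_le_of_surjective (A ⧸ I) f hf
  have hlt : Fintype.card {i : Fin n // j < i} < Fintype.card {l : Fin n // j ≤ l} :=
    Fintype.card_lt_of_injective_of_notMem (fun i ↦ ⟨i.1, i.2.le⟩)
      (fun x y h ↦ Subtype.ext (congrArg (fun z ↦ z.1) h)) (b := ⟨j, le_rfl⟩) (by
        rintro ⟨i, hi⟩
        exact i.2.ne' (congrArg (fun z ↦ z.1) hi))
  omega

/-! ### Independence of Frobenius powers on a finite field. -/

section FrobeniusPowers

variable {Fq k : Type*} [Field Fq] [Finite Fq] [Field k] [Finite k] [Algebra Fq k]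

theorem pow_card_pow_eq_frobenius (Fq : Type*) {k : Type*} [Field Fq] [Fintype Fq] [Field k]
    [Algebra Fq k] (n : ℕ) (x : k) :
    x ^ Nat.card Fq ^ n = (FiniteField.frobeniusAlgHom Fq k ^ n) x := by
  rw [AlgHom.coe_pow, FiniteField.coe_frobeniusAlgHom, pow_iterate, Nat.card_eq_fintype_card]

variable (Fq) in
theorem pow_card_pow_surjective (n : ℕ) : Function.Surjective fun x : k ↦ x ^ Nat.card Fq ^ n := by
  have := Fintype.ofFinite Fq
  refine Finite.surjective_of_injective fun x y h ↦ ?_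
  simp only [pow_card_pow_eq_frobenius Fq] at h
  exact (FiniteField.frobeniusAlgHom Fq k ^ n).toRingHom.injective h

theorem pow_card_pow_finrank (Fq : Type*) {k : Type*} [Field Fq] [Field k] [Finite k]
    [Algebra Fq k] (x : k) : x ^ Nat.card Fq ^ Module.finrank Fq k = x := by
  have := Fintype.ofFinite k
  rw [← Module.natCard_eq_pow_finrank, Nat.card_eq_fintype_card, FiniteField.pow_card]

/-- The powers of the Frobenius with exponents that are distinct modulo `[k : Fq]` are linearly
independent over `k`. -/
theorem eq_zero_of_sum_mul_pow_card_pow {ι : Type*} [Fintype ι] (g : ι → ℕ)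
    (hg : ∀ i j, g i ≡ g j [MOD Module.finrank Fq k] → i = j) (y : ι → k)
    (h : ∀ β : k, ∑ i, y i * β ^ Nat.card Fq ^ g i = 0) (i : ι) : y i = 0 := by
  have := Fintype.ofFinite Fq
  let χ : ι → (k →* k) := fun i ↦ ((FiniteField.frobeniusAlgHom Fq k ^ g i : k →ₐ[Fq] k) : k →* k)
  -- The q-Frobenius has order [k : F_q], so incongruent exponents give distinct characters and
  -- Dedekind's independence applies.
  have hχ : Function.Injective χ := fun i j hij ↦ hg i j (by
    rw [← FiniteField.orderOf_frobeniusAlgHom Fq k,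
      ← (orderOf_pos_iff.mp (FiniteField.orderOf_frobeniusAlgHom Fq k ▸
        Module.finrank_pos)).pow_eq_pow_iff_modEq]
    exact AlgHom.ext fun x ↦ DFunLike.congr_fun hij x)
  have hlin := (linearIndependent_monoidHom k k).comp χ hχ
  refine Fintype.linearIndependent_iff.mp hlin y (funext fun β ↦ ?_) i
  rw [Finset.sum_apply, Pi.zero_apply, ← h β]
  refine Finset.sum_congr rfl fun i _ ↦ ?_
  rw [pow_card_pow_eq_frobenius]
  rfl

/-- The Moore matrix of a basis of `k` over `Fq` is invertible. -/
theorem eq_zero_of_sum_mul_basis_pow {ι : Type*} [Fintype ι] (α : Module.Basis ι Fq k) (M : ℕ)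
    (b : ι → k) (h : ∀ c, ∑ j, b j * α j ^ Nat.card Fq ^ (M + c) = 0) (j : ι) : b j = 0 := by
  classical
  have := Fintype.ofFinite Fq
  let e : ι ≃ Fin (Module.finrank Fq k) :=
    Fintype.equivFinOfCardEq (Module.finrank_eq_card_basis α).symm
  let X : Matrix ι ι k := Matrix.of fun i j ↦ α j ^ Nat.card Fq ^ (M + e i)
  have hX : IsUnit X := by
    rw [← Matrix.linearIndependent_rows_iff_isUnit, Fintype.linearIndependent_iff]
    intro y hy
    refine eq_zero_of_sum_mul_pow_card_pow (Fq := Fq) (fun i ↦ M + e i) (fun i j hij ↦ ?_) y ?_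
    · have := Nat.ModEq.add_left_cancel' M hij
      exact e.injective (Fin.ext (this.eq_of_lt_of_lt (e i).2 (e j).2))
    -- A relation between rows holds at each basis vector, hence on all of k by F_q-linearity.
    · obtain ⟨F, hF⟩ : ∃ F : ℕ → k →ₗ[Fq] k, ∀ n x, F n x = x ^ Nat.card Fq ^ n :=
        ⟨fun n ↦ (FiniteField.frobeniusAlgHom Fq k ^ n : k →ₐ[Fq] k).toLinearMap,
          fun n x ↦ (pow_card_pow_eq_frobenius Fq n x).symm⟩
      let f : k →ₗ[Fq] k := ∑ i, LinearMap.mulLeft Fq (y i) ∘ₗ F (M + e i)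
      have hf : f = 0 := α.ext fun j ↦ by
        have := congrFun hy j
        rw [Finset.sum_apply] at this
        simpa [f, X, Matrix.row, hF] using this
      intro β
      have := LinearMap.congr_fun hf β
      simpa [f, hF] using this
  have hXb : X.mulVec b = 0 := funext fun i ↦ by
    have := h (e i)
    simp only [Matrix.mulVec, dotProduct, X, Matrix.of_apply, Pi.zero_apply]
    rw [← this]
    exact Finset.sum_congr rfl fun j _ ↦ mul_comm _ _
  exact congrFun (Matrix.eq_zero_of_mulVec_eq_zero
    ((Matrix.isUnit_iff_isUnit_det X).mp hX).ne_zero hXb) j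

end FrobeniusPowers

/-! ### Coefficients and products in L{τ}. -/

namespace TwistedPolynomial

variable {Fq : Type*} {L : Type*} [Field Fq] [Finite Fq] [Field L] [Algebra Fq L]

variable (Fq) in
/-- The twisted polynomial `a τ ^ n`. -/
noncomputable def monomial (n : ℕ) (a : L) : TwistedPolynomial Fq L :=
  SkewPolynomial.monomial n (FrobTwist.of Fq L a)

theorem ext {f g : TwistedPolynomial Fq L} (h : ∀ n, f.coeff n = g.coeff n) : f = g :=
  SkewPolynomial.ext fun n ↦ (FrobTwist.of Fq L).symm.injective (h n)

theorem coeff_monomial (n m : ℕ) (a : L) : (monomial Fq n a).coeff m = if n = m then a else 0 := by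
  rw [coeff, monomial, SkewPolynomial.coeff_monomial]
  split_ifs <;> simp

theorem coeff_zero' (n : ℕ) : (0 : TwistedPolynomial Fq L).coeff n = 0 := rfl

theorem coeff_add (f g : TwistedPolynomial Fq L) (n : ℕ) :
    (f + g).coeff n = f.coeff n + g.coeff n := by
  rw [coeff, SkewPolynomial.coeff_add, map_add]; rfl

theorem coeff_sub (f g : TwistedPolynomial Fq L) (n : ℕ) :
    (f - g).coeff n = f.coeff n - g.coeff n := by
  rw [coeff, SkewPolynomial.coeff_sub, map_sub]; rfl

/-- Taking a coefficient, as an additive map. -/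
def coeffHom (n : ℕ) : TwistedPolynomial Fq L →+ L where
  toFun f := f.coeff n
  map_zero' := coeff_zero' n
  map_add' f g := coeff_add f g n

theorem coeff_sum {ι : Type*} (s : Finset ι) (f : ι → TwistedPolynomial Fq L) (n : ℕ) :
    (∑ i ∈ s, f i).coeff n = ∑ i ∈ s, (f i).coeff n :=
  map_sum (coeffHom n) f s

theorem monomial_mul_monomial (m n : ℕ) (a b : L) :
    monomial Fq m a * monomial Fq n b = monomial Fq (m + n) (a * b ^ Nat.card Fq ^ m) := by
  rw [monomial, monomial, SkewPolynomial.monomial_mul_monomial, SkewPolynomial.φ_iterate_apply,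
    FrobTwist.smul_def]
  rfl

theorem const_eq_monomial (a : L) : const Fq L a = monomial Fq 0 a := rfl

theorem monomial_add (n : ℕ) (a b : L) :
    monomial Fq n (a + b) = monomial Fq n a + monomial Fq n b := by
  rw [monomial, map_add, SkewPolynomial.monomial_add]; rfl

variable (Fq) in
/-- `a ↦ a τ ^ n` as an additive map. -/
noncomputable def monomialHom (n : ℕ) : L →+ TwistedPolynomial Fq L :=
  AddMonoidHom.mk' (monomial Fq n) (monomial_add n)

theorem monomial_sum {ι : Type*} (s : Finset ι) (f : ι → L) (n : ℕ) :
    monomial Fq n (∑ i ∈ s, f i) = ∑ i ∈ s, monomial Fq n (f i) :=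
  map_sum (monomialHom Fq n) f s

theorem induction_on {P : TwistedPolynomial Fq L → Prop} (f : TwistedPolynomial Fq L)
    (zero : P 0) (monomial_add : ∀ n a f, P f → P (monomial Fq n a + f)) : P f :=
  SkewPolynomial.induction f zero fun n a f _ _ h ↦
    monomial_add n ((FrobTwist.of Fq L).symm a) f h

theorem coeff_mul (f g : TwistedPolynomial Fq L) (N : ℕ) :
    (f * g).coeff N =
      ∑ x ∈ Finset.HasAntidiagonal.antidiagonal N, f.coeff x.1 * g.coeff x.2 ^ Nat.card Fq ^ x.1 := by
  induction f using induction_on with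
  | zero => simp [coeff_zero']
  | monomial_add m a f hf =>
    rw [add_mul, coeff_add, hf]
    simp only [coeff_add, add_mul, Finset.sum_add_distrib]
    congr 1
    clear hf
    induction g using induction_on with
    | zero =>
      have : ∀ n, (0 : L) ^ Nat.card Fq ^ n = 0 := fun n ↦ zero_pow (pow_ne_zero _ Nat.card_pos.ne')
      simp [coeff_zero', this]
    | monomial_add n b g hg =>
      rw [mul_add, coeff_add, hg]
      simp only [coeff_add, FrobTwist.add_pow_card_pow, mul_add, Finset.sum_add_distrib]
      congr 1
      rw [monomial_mul_monomial]
      simp only [coeff_monomial]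
      split_ifs with h
      · subst h
        rw [Finset.sum_eq_single (m, n)]
        · simp
        · rintro ⟨i, j⟩ hij hne
          rw [Finset.HasAntidiagonal.mem_antidiagonal] at hij
          have : m ≠ i := by
            rintro rfl
            exact hne (congrArg _ (Nat.add_left_cancel hij))
          simp [this]
        · simp
      · refine (Finset.sum_eq_zero ?_).symm
        rintro ⟨i, j⟩ hij
        rw [Finset.HasAntidiagonal.mem_antidiagonal] at hij
        by_cases hm : m = i
        · have : n ≠ j := by rintro rfl; exact h (hm ▸ hij)
          simp only [this, if_false]
          rw [zero_pow (pow_ne_zero _ Nat.card_pos.ne'), mul_zero]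
        · simp [hm]

theorem exists_coeff_eq_zero_of_le (f : TwistedPolynomial Fq L) : ∃ N, ∀ n, N ≤ n → f.coeff n = 0 := by
  induction f using induction_on with
  | zero => exact ⟨0, fun _ _ ↦ rfl⟩
  | monomial_add m a f hf =>
    obtain ⟨N, hN⟩ := hf
    refine ⟨max N (m + 1), fun n hn ↦ ?_⟩
    rw [coeff_add, hN n (le_of_max_le_left hn), coeff_monomial, if_neg, add_zero]
    have := le_of_max_le_right hn
    omega

theorem exists_top_coeff {f : TwistedPolynomial Fq L} (hf : f ≠ 0) :
    ∃ m, f.coeff m ≠ 0 ∧ ∀ n, m < n → f.coeff n = 0 := by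
  classical
  have h := exists_coeff_eq_zero_of_le f
  let N := Nat.find h
  have hN : ∀ n, N ≤ n → f.coeff n = 0 := Nat.find_spec h
  have h0 : N ≠ 0 := fun h0 ↦ hf (ext fun n ↦ hN n (h0 ▸ Nat.zero_le n))
  refine ⟨N - 1, fun hz ↦ Nat.find_min h (m := N - 1) (by omega) fun n hn ↦ ?_,
    fun n hn ↦ hN n (by omega)⟩
  rcases hn.eq_or_lt with rfl | hn
  · exact hz
  · exact hN n (by omega)

instance : NoZeroDivisors (TwistedPolynomial Fq L) where
  eq_zero_or_eq_zero_of_mul_eq_zero {f g} h := by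
    by_contra! hne
    obtain ⟨m, hm, hm'⟩ := exists_top_coeff hne.1
    obtain ⟨n, hn, hn'⟩ := exists_top_coeff hne.2
    have h1 := TwistedPolynomial.coeff_mul f g (m + n)
    rw [h, coeff_zero', Finset.sum_eq_single (m, n)] at h1
    · exact mul_ne_zero hm (pow_ne_zero _ hn) h1.symm
    · rintro ⟨i, j⟩ hij hne
      rw [Finset.HasAntidiagonal.mem_antidiagonal] at hij
      rcases lt_trichotomy i m with hi | rfl | hi
      · rw [hn' j (by simp only at hij; omega), zero_pow (pow_ne_zero _ Nat.card_pos.ne'), mul_zero]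
      · exact absurd (congrArg _ (Nat.add_left_cancel hij)) hne
      · rw [hm' i hi, zero_mul]
    · simp

/-- The operators `x ↦ l x s`, where `s` runs through a basis of `k{τ}` over its centre, are
independent over `k{τ}`. -/
theorem eq_zero_of_sum_mul_mul_monomial [Finite L] {ι : Type*} [Fintype ι]
    (α : Module.Basis ι Fq L) (l : Fin (Module.finrank Fq L) → ι → TwistedPolynomial Fq L)
    (h : ∀ x, ∑ i, ∑ j, l i j * x * monomial Fq (i : ℕ) (α j) = 0)
    (i : Fin (Module.finrank Fq L)) (j : ι) : l i j = 0 := by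
  -- The exponent of β is naturally K - e. Adding the degree n = [L : F_q] does not change the
  -- power, and makes the exponent meaningful for e > K too, so that all e < n give exponents
  -- distinct modulo n.
  have hterm : ∀ (u : TwistedPolynomial Fq L) (c e K : ℕ) (β a : L),
      (u * monomial Fq c β * monomial Fq e a).coeff (K + c) =
        if e ≤ K then u.coeff (K - e) * (a ^ Nat.card Fq ^ (K - e + c)) * β ^ Nat.card Fq ^ (K + Module.finrank Fq L - e)
        else 0 := by
    intro u c e K β a
    rw [mul_assoc, monomial_mul_monomial, TwistedPolynomial.coeff_mul]
    simp only [coeff_monomial]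
    split_ifs with hK
    · rw [Finset.sum_eq_single (K - e, c + e)]
      · simp only [if_true]
        have hβ : β ^ Nat.card Fq ^ (K + Module.finrank Fq L - e) = β ^ Nat.card Fq ^ (K - e) := by
          rw [show K + Module.finrank Fq L - e = Module.finrank Fq L + (K - e) by omega, pow_add,
            pow_mul, pow_card_pow_finrank]
        rw [hβ, mul_pow, ← pow_mul a, ← pow_add, add_comm c]
        ring
      · rintro ⟨i, j⟩ hij hne
        rw [Finset.HasAntidiagonal.mem_antidiagonal] at hij
        have : c + e ≠ j := by
          rintro rfl
          exact hne (by rw [show i = K - e by simp only at hij; omega])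
        rw [if_neg this, zero_pow (pow_ne_zero _ Nat.card_pos.ne'), mul_zero]
      · intro h
        rw [Finset.HasAntidiagonal.mem_antidiagonal] at h
        exact absurd (by simp only; omega) h
    · refine Finset.sum_eq_zero ?_
      rintro ⟨i, j⟩ hij
      rw [Finset.HasAntidiagonal.mem_antidiagonal] at hij
      rw [if_neg (by simp only at hij; omega), zero_pow (pow_ne_zero _ Nat.card_pos.ne'), mul_zero]
  refine ext fun M ↦ ?_
  rw [coeff_zero']
  refine eq_zero_of_sum_mul_basis_pow α M (fun j ↦ (l i j).coeff M) (fun c ↦ ?_) j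
  -- Chosen so that the term with e = i picks out the coefficient of τ^M in `l i j`. Testing on β
  -- τ^c, varying β separates the indices e; varying c then separates the basis vectors through the
  -- Moore matrix.
  let K := M + i
  have key := eq_zero_of_sum_mul_pow_card_pow (Fq := Fq) (k := L)
    (fun e : Fin (Module.finrank Fq L) ↦ K + Module.finrank Fq L - (e : ℕ)) (fun e e' he ↦ ?_)
    (fun e ↦ if (e : ℕ) ≤ K then
      ∑ j, (l e j).coeff (K - e) * α j ^ Nat.card Fq ^ (K - e + c) else 0) (fun β ↦ ?_) i
  · rw [if_pos (Nat.le_add_left _ _)] at key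
    rw [← key, show K - i = M from Nat.add_sub_cancel _ _]
  · have he' : K + Module.finrank Fq L - (e : ℕ) + (e + e') ≡
        K + Module.finrank Fq L - (e' : ℕ) + (e + e') [MOD Module.finrank Fq L] := he.add_right _
    have h1 := e.2
    have h2 := e'.2
    rw [show K + Module.finrank Fq L - (e : ℕ) + (e + e') = K + Module.finrank Fq L + e' by omega,
      show K + Module.finrank Fq L - (e' : ℕ) + (e + e') = K + Module.finrank Fq L + e by omega] at he'
    exact Fin.ext ((Nat.ModEq.add_left_cancel' _ he').eq_of_lt_of_lt h2 h1).symm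
  · have h1 := congrArg (fun f ↦ coeff f (K + c)) (h (monomial Fq c β))
    simp only [coeff_sum, coeff_zero', hterm] at h1
    refine Eq.trans (Finset.sum_congr rfl fun e _ ↦ ?_) h1
    by_cases he : (e : ℕ) ≤ K
    · simp only [if_pos he, Finset.sum_mul]
    · simp only [if_neg he, zero_mul, Finset.sum_const_zero]

end TwistedPolynomial

/-! ### The bound on the rank of the endomorphism ring. -/

/-- If every nonzero element of `M` generates a free module of rank `r` over `A[P]`, then an
endomorphism that commutes with `P` is determined by its values at `rank M / r` elements. -/
theorem exists_determining_family {A M : Type*} [CommRing A] [IsDomain A] [AddCommGroup M]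
    [Module A M] [Module.Finite A M] (P : M →ₗ[A] M) {r n : ℕ} (hr : 0 < r)
    (hP : ∀ y, y ≠ 0 → ∀ a : Fin r → A, ∑ j, a j • (P ^ (j : ℕ)) y = 0 → a = 0)
    (hM : Module.finrank A M ≤ r * n) :
    ∃ m ≤ n, ∃ x : Fin m → M, ∀ T : M →ₗ[A] M, Commute T P → (∀ i, T (x i) = 0) → T = 0 := by
  let Q : ℕ → Prop := fun m ↦ ∃ x : Fin m → M,
    LinearIndependent A fun p : Fin m × Fin r ↦ (P ^ (p.2 : ℕ)) (x p.1)
  have hbound : ∀ m, Q m → m ≤ n := by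
    rintro m ⟨x, hx⟩
    have h := hx.fintype_card_le_finrank.trans hM
    rw [Fintype.card_prod, Fintype.card_fin, Fintype.card_fin, mul_comm] at h
    exact Nat.le_of_mul_le_mul_left h hr
  -- Take a family that cannot be lengthened. If T kills it but `T y ≠ 0`, then applying T to a
  -- relation involving y kills the coefficients of y, so y could be adjoined after all.
  have hQ : ∃ m, Q m ∧ ¬ Q (m + 1) := by
    by_contra! h
    have hall : ∀ m, Q m := fun m ↦ by
      induction m with
      | zero => exact ⟨Fin.elim0, linearIndependent_empty_type⟩
      | succ m ih => exact h m ih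
    exact absurd (hbound _ (hall (n + 1))) (by omega)
  obtain ⟨m, ⟨x, hx⟩, hmax⟩ := hQ
  refine ⟨m, hbound m ⟨x, hx⟩, x, fun T hT hTx ↦ LinearMap.ext fun y ↦ ?_⟩
  have hTP : ∀ (j : ℕ) z, T ((P ^ j) z) = (P ^ j) (T z) := fun j z ↦
    LinearMap.congr_fun (hT.pow_right j) z
  by_contra hTy
  apply hmax
  refine ⟨Fin.cons y x, Fintype.linearIndependent_iff.mpr fun g hg ↦ ?_⟩
  rw [Fintype.sum_prod_type, Fin.sum_univ_succ] at hg
  simp only [Fin.cons_zero, Fin.cons_succ] at hg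
  have h0 : (fun j ↦ g (0, j)) = 0 := by
    apply hP (T y) hTy
    have h1 := congrArg T hg
    simpa [hTP, hTx] using h1
  have h0' : ∀ j, g (0, j) = 0 := fun j ↦ congrFun h0 j
  simp only [h0', zero_smul, Finset.sum_const_zero, zero_add] at hg
  have h2 := Fintype.linearIndependent_iff.mp hx (fun p ↦ g (p.1.succ, p.2)) (by
    rw [Fintype.sum_prod_type]
    exact hg)
  rintro ⟨i, j⟩
  refine Fin.cases (h0' j) (fun i ↦ h2 (i, j)) i

namespace DrinfeldModule

section LeftModule

variable {Fq : Type*} {L : Type*} [Field Fq] [Finite Fq] [Field L] [Algebra Fq L]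
  {γ : Fq[X] →ₐ[Fq] L} {r : ℕ} (φ : DrinfeldModule γ r)

/-- A copy of `L{τ}`, on which `a ∈ A` acts as left multiplication by `φ_a`. -/
def LeftModule (_φ : DrinfeldModule γ r) := TwistedPolynomial Fq L

noncomputable instance : Ring φ.LeftModule := inferInstanceAs (Ring (TwistedPolynomial Fq L))

instance : NoZeroDivisors φ.LeftModule :=
  inferInstanceAs (NoZeroDivisors (TwistedPolynomial Fq L))

noncomputable instance : Module Fq[X] φ.LeftModule :=
  Module.compHom (TwistedPolynomial Fq L) φ.toRingHom

/-- The identity map from `L{τ}` to its copy. -/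
noncomputable def toLeft : TwistedPolynomial Fq L ≃+* φ.LeftModule := RingEquiv.refl _

theorem smul_toLeft (a : Fq[X]) (x : TwistedPolynomial Fq L) :
    a • φ.toLeft x = φ.toLeft (φ.toRingHom a * x) := rfl

instance : IsScalarTower Fq[X] φ.LeftModule φ.LeftModule where
  smul_assoc a x y := mul_assoc (φ.toRingHom a) x y

/-- The inclusion of `End_L(φ)` in `L{τ}`. -/
noncomputable def endRingInclusion : φ.endRing →ₗ[Fq[X]] φ.LeftModule where
  toFun u := φ.toLeft u
  map_add' _ _ := rfl
  map_smul' _ _ := rfl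

theorem endRingInclusion_injective : Function.Injective φ.endRingInclusion :=
  fun _ _ h ↦ Subtype.ext h

theorem endRingInclusion_mul (u v : φ.endRing) :
    φ.endRingInclusion (u * v) = φ.endRingInclusion u * φ.endRingInclusion v := rfl

theorem endRingInclusion_mul_smul (u : φ.endRing) (a : Fq[X]) (x : φ.LeftModule) :
    φ.endRingInclusion u * a • x = a • (φ.endRingInclusion u * x) := by
  have h := Subring.mem_centralizer_iff.mp u.2 (φ.toRingHom a) ⟨a, rfl⟩
  change (u : TwistedPolynomial Fq L) * (φ.toRingHom a * φ.toLeft.symm x) =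
    φ.toRingHom a * (u * φ.toLeft.symm x)
  rw [← mul_assoc, ← h, mul_assoc]

theorem isTorsionFree_leftModule (h : Function.Injective φ.toRingHom) :
    Module.IsTorsionFree Fq[X] φ.LeftModule :=
  .of_smul_eq_zero fun a x hax ↦ by
    have h1 : φ.toRingHom a * (φ.toLeft.symm x) = 0 := hax
    rcases mul_eq_zero.mp h1 with h2 | h2
    · exact Or.inl (h (h2.trans (map_zero _).symm))
    · exact Or.inr h2

theorem isTorsionFree_endRing (h : Function.Injective φ.toRingHom) :
    Module.IsTorsionFree Fq[X] φ.endRing :=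
  have := φ.isTorsionFree_leftModule h
  φ.endRingInclusion_injective.moduleIsTorsionFree _ (fun a u ↦ map_smul φ.endRingInclusion a u)

/-- The endomorphism `x ↦ u x s` of `k{τ}`. -/
noncomputable def sandwich (u : φ.endRing) (s : φ.LeftModule) :
    φ.LeftModule →ₗ[Fq[X]] φ.LeftModule where
  toFun x := φ.endRingInclusion u * x * s
  map_add' x y := by rw [mul_add, add_mul]
  map_smul' a x := by rw [endRingInclusion_mul_smul, smul_mul_assoc, RingHom.id_apply]

theorem sandwich_apply (u : φ.endRing) (s x : φ.LeftModule) :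
    φ.sandwich u s x = φ.endRingInclusion u * x * s := rfl

end LeftModule

section Finite

variable {Fq : Type*} {k : Type*} [Field Fq] [Finite Fq] [Field k] [Finite k] [Algebra Fq k]
  {γ : Fq[X] →ₐ[Fq] k} {r : ℕ} (φ : DrinfeldModule γ r)

/-- Division by φ_T: a leading term of degree at least r is matched by a multiple of φ_T, because k
is perfect, and the degree drops. -/
theorem span_monomial_eq_top {ι : Type*} [Fintype ι] (α : Module.Basis ι Fq k) :
    Submodule.span Fq[X] (Set.range fun p : Fin r × ι ↦
      φ.toLeft (TwistedPolynomial.monomial Fq (p.1 : ℕ) (α p.2))) = ⊤ := by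
  set W := Submodule.span Fq[X] (Set.range fun p : Fin r × ι ↦
      φ.toLeft (TwistedPolynomial.monomial Fq (p.1 : ℕ) (α p.2)))
  have hr := φ.rank_pos
  have hmon : ∀ i < r, ∀ c : k, φ.toLeft (TwistedPolynomial.monomial Fq i c) ∈ W := by
    intro i hi c
    rw [← α.sum_repr c, TwistedPolynomial.monomial_sum, map_sum]
    refine sum_mem fun j _ ↦ ?_
    have h : TwistedPolynomial.monomial Fq i (α.repr c j • α j) =
        φ.toRingHom (C (α.repr c j)) * TwistedPolynomial.monomial Fq i (α j) := by
      rw [φ.map_C, TwistedPolynomial.const_eq_monomial, TwistedPolynomial.monomial_mul_monomial,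
        zero_add, pow_zero, pow_one, Algebra.smul_def]
    rw [h, ← smul_toLeft]
    exact Submodule.smul_mem _ _ (Submodule.subset_span ⟨(⟨i, hi⟩, j), rfl⟩)
  have key : ∀ d, ∀ f : TwistedPolynomial Fq k, (∀ n, d ≤ n → f.coeff n = 0) → φ.toLeft f ∈ W := by
    intro d
    induction d with
    | zero =>
      intro f hf
      rw [show f = 0 from TwistedPolynomial.ext fun n ↦ hf n (Nat.zero_le n), map_zero]
      exact zero_mem _
    | succ d ih =>
      intro f hf
      suffices h : ∃ g, φ.toLeft g ∈ W ∧ g.coeff d = f.coeff d ∧ ∀ n, d < n → g.coeff n = 0 by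
        obtain ⟨g, hg, h1, h2⟩ := h
        rw [← sub_add_cancel f g, map_add]
        refine add_mem (ih _ fun n hn ↦ ?_) hg
        rw [TwistedPolynomial.coeff_sub]
        rcases hn.eq_or_lt with rfl | hn
        · rw [h1, sub_self]
        · rw [hf n hn, h2 n hn, sub_self]
      rcases lt_or_ge d r with hd | hd
      · refine ⟨TwistedPolynomial.monomial Fq d (f.coeff d), hmon d hd _, ?_, fun n hn ↦ ?_⟩
        · rw [TwistedPolynomial.coeff_monomial, if_pos rfl]
        · rw [TwistedPolynomial.coeff_monomial, if_neg hn.ne]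
      -- The leading coefficient of φ_T · s τ^(d-r) is g_r s^(q^r), so s is a q^r-th root of f_d /
      -- g_r.
      · obtain ⟨s, hs⟩ := pow_card_pow_surjective Fq r
          (f.coeff d * ((φ.toRingHom X).coeff r)⁻¹)
        have hcoeff : ∀ n, (φ.toRingHom X * TwistedPolynomial.monomial Fq (d - r) s).coeff (r + n) =
            if d - r ≤ r + n then
              (φ.toRingHom X).coeff (r + n - (d - r)) * s ^ Nat.card Fq ^ (r + n - (d - r)) else 0 := by
          intro n
          rw [TwistedPolynomial.coeff_mul]
          simp only [TwistedPolynomial.coeff_monomial]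
          split_ifs with hn
          · rw [Finset.sum_eq_single (r + n - (d - r), d - r)]
            · simp
            · rintro ⟨i, j⟩ hij hne
              rw [Finset.HasAntidiagonal.mem_antidiagonal] at hij
              rw [if_neg, zero_pow (pow_ne_zero _ Nat.card_pos.ne'), mul_zero]
              rintro h
              simp only at h hij
              exact hne (by rw [Prod.mk.injEq]; omega)
            · intro h
              rw [Finset.HasAntidiagonal.mem_antidiagonal] at h
              exact absurd (by simp only; omega) h
          · refine Finset.sum_eq_zero ?_
            rintro ⟨i, j⟩ hij
            rw [Finset.HasAntidiagonal.mem_antidiagonal] at hij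
            rw [if_neg (by simp only at hij ⊢; omega), zero_pow (pow_ne_zero _ Nat.card_pos.ne'),
              mul_zero]
        refine ⟨φ.toRingHom X * TwistedPolynomial.monomial Fq (d - r) s, ?_, ?_, fun n hn ↦ ?_⟩
        · rw [← smul_toLeft]
          refine Submodule.smul_mem _ _ (ih _ fun n hn ↦ ?_)
          rw [TwistedPolynomial.coeff_monomial, if_neg (by omega)]
        · have h := hcoeff (d - r)
          rw [show r + (d - r) = d by omega, if_pos (Nat.sub_le _ _), Nat.sub_sub_self hd] at h
          rw [h]
          change _ * (fun x ↦ x ^ Nat.card Fq ^ r) s = _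
          rw [hs, mul_comm, mul_assoc, inv_mul_cancel₀ φ.coeff_rank, mul_one]
        · have h := hcoeff (n - r)
          rw [show r + (n - r) = n by omega, if_pos (by omega), φ.coeff_of_gt _ (by omega),
            zero_mul] at h
          exact h
  refine eq_top_iff.mpr fun f _ ↦ ?_
  obtain ⟨N, hN⟩ := TwistedPolynomial.exists_coeff_eq_zero_of_le (φ.toLeft.symm f)
  exact key N _ hN

instance : Module.Finite Fq[X] φ.LeftModule := by
  let α := Module.finBasis Fq k
  exact ⟨⟨(Set.finite_range _).toFinset, by
    rw [Set.Finite.coe_toFinset]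
    exact φ.span_monomial_eq_top α⟩⟩

theorem finrank_leftModule_le :
    Module.finrank Fq[X] φ.LeftModule ≤ r * Module.finrank Fq k := by
  have h := finrank_range_le_card (R := Fq[X]) fun p : Fin r × Fin (Module.finrank Fq k) ↦
      φ.toLeft (TwistedPolynomial.monomial Fq (p.1 : ℕ) (Module.finBasis Fq k p.2))
  rwa [Set.finrank, φ.span_monomial_eq_top, finrank_top, Fintype.card_prod, Fintype.card_fin,
    Fintype.card_fin] at h

instance : Module.Finite Fq[X] φ.endRing :=
  Module.Finite.of_injective φ.endRingInclusion φ.endRingInclusion_injective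

theorem frob_mul (x : φ.LeftModule) :
    φ.endRingInclusion φ.frob * x = x * φ.endRingInclusion φ.frob :=
  TwistedPolynomial.tau_pow_mul Fq k (pow_card_pow_finrank Fq) x

/-- If `A[π]` has rank `r`, then `End_k(φ)` has rank at most `r`. -/
theorem finrank_endRing_le (hinj : Function.Injective φ.toRingHom)
    (hπ : LinearIndependent Fq[X] fun i : Fin r ↦ φ.frob ^ (i : ℕ)) :
    Module.finrank Fq[X] φ.endRing ≤ r := by
  have := φ.isTorsionFree_leftModule hinj
  have := φ.isTorsionFree_endRing hinj
  set n := Module.finrank Fq k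
  have hn0 : 0 < n := Module.finrank_pos
  let α := Module.finBasis Fq k
  let P := φ.sandwich φ.frob 1
  have hPpow : ∀ (j : ℕ) x, (P ^ j) x = φ.endRingInclusion (φ.frob ^ j) * x := by
    intro j x
    induction j with
    | zero => exact (one_mul x).symm
    | succ j ih =>
      rw [pow_succ', Module.End.mul_apply, ih, sandwich_apply, mul_one, ← mul_assoc, pow_succ',
        endRingInclusion_mul]
  -- The freeness hypothesis holds because k{τ} has no zero divisors: a relation between the π^j y
  -- is a relation between the π^j.
  obtain ⟨m, hm, x, hx⟩ := exists_determining_family P (n := n) φ.rank_pos (fun y hy a ha ↦ by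
    simp only [hPpow, ← smul_mul_assoc, ← Finset.sum_mul, ← map_smul, ← map_sum] at ha
    have h1 := (mul_eq_zero.mp ha).resolve_right hy
    have h2 := φ.endRingInclusion_injective (h1.trans (map_zero _).symm)
    exact funext (Fintype.linearIndependent_iff.mp hπ a h2)) φ.finrank_leftModule_le
  let e := Module.finBasis Fq[X] φ.endRing
  let s : Fin n → Fin n → φ.LeftModule := fun i j ↦
    φ.toLeft (TwistedPolynomial.monomial Fq (i : ℕ) (α j))
  let T : Fin (Module.finrank Fq[X] φ.endRing) × Fin n × Fin n →
    φ.LeftModule →ₗ[Fq[X]] φ.LeftModule := fun p ↦ φ.sandwich (e p.1) (s p.2.1 p.2.2)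
  -- π is central in k{τ}.
  have hTP : ∀ p, Commute (T p) P := fun p ↦ LinearMap.ext fun y ↦ by
    simp only [Module.End.mul_apply, T, P, sandwich_apply, mul_one, frob_mul, mul_assoc]
  have hindep : LinearIndependent Fq[X] fun p ↦ fun i : Fin m ↦ T p (x i) := by
    rw [Fintype.linearIndependent_iff]
    intro g hg
    have h0 : ∑ p, g p • T p = 0 := by
      refine hx _ (Commute.sum_left _ _ _ fun p _ ↦ (hTP p).smul_left _) fun i ↦ ?_
      have := congrFun hg i
      simpa using this
    have h1 : ∀ i j, ∑ a, g (a, i, j) • φ.endRingInclusion (e a) = 0 := by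
      refine TwistedPolynomial.eq_zero_of_sum_mul_mul_monomial α
        (fun i j ↦ φ.toLeft.symm (∑ a, g (a, i, j) • φ.endRingInclusion (e a))) fun y ↦ ?_
      have h2 := LinearMap.congr_fun h0 (φ.toLeft y)
      rw [LinearMap.sum_apply, Fintype.sum_prod_type, Finset.sum_comm, Fintype.sum_prod_type] at h2
      refine Eq.trans (Finset.sum_congr rfl fun i _ ↦ Finset.sum_congr rfl fun j _ ↦ ?_) h2
      change (∑ a, g (a, i, j) • φ.endRingInclusion (e a)) * φ.toLeft y * s i j = _
      rw [Finset.sum_mul, Finset.sum_mul]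
      refine Finset.sum_congr rfl fun a _ ↦ ?_
      rw [smul_mul_assoc, smul_mul_assoc]
      rfl
    rintro ⟨a, i, j⟩
    refine Fintype.linearIndependent_iff.mp e.linearIndependent (fun a ↦ g (a, i, j)) ?_ a
    apply φ.endRingInclusion_injective
    rw [map_zero, map_sum, ← h1 i j]
    exact Finset.sum_congr rfl fun a _ ↦ map_smul _ _ _
  have hcard := hindep.fintype_card_le_finrank
  rw [Module.finrank_pi_fintype, Finset.sum_const, Finset.card_univ, Fintype.card_fin,
    Fintype.card_prod, Fintype.card_prod, Fintype.card_fin, Fintype.card_fin, smul_eq_mul] at hcard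
  have h3 : m * Module.finrank Fq[X] φ.LeftModule ≤ n * (r * n) :=
    Nat.mul_le_mul hm φ.finrank_leftModule_le
  refine Nat.le_of_mul_le_mul_right (c := n * n) ?_ (Nat.mul_pos hn0 hn0)
  calc _ ≤ _ := hcard
    _ ≤ _ := h3
    _ = _ := by ring

end Finite

end DrinfeldModule

/-! ### Full-rank spans and algebras generated by one element. -/

theorem exists_smul_mem_span_of_finrank_le {A M : Type*} [CommRing A] [IsDomain A] [AddCommGroup M]
    [Module A M] [Module.Finite A M] {r : ℕ} {v : Fin r → M} (hv : LinearIndependent A v)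
    (hr : Module.finrank A M ≤ r) (u : M) :
    ∃ a : A, a ≠ 0 ∧ a • u ∈ Submodule.span A (Set.range v) := by
  have h : ¬ LinearIndependent A (Fin.cons u v : Fin (r + 1) → M) := fun h ↦ by
    have := h.fintype_card_le_finrank
    rw [Fintype.card_fin] at this
    omega
  rw [Fintype.linearIndependent_iff] at h
  push Not at h
  obtain ⟨g, hg, i, hi⟩ := h
  rw [Fin.sum_univ_succ] at hg
  simp only [Fin.cons_zero, Fin.cons_succ] at hg
  refine ⟨g 0, fun h0 ↦ hi ?_, ?_⟩
  · rw [h0, zero_smul, zero_add] at hg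
    have := Fintype.linearIndependent_iff.mp hv (fun j ↦ g j.succ) hg
    exact Fin.cases h0 this i
  · rw [eq_neg_of_add_eq_zero_left hg]
    exact neg_mem (sum_mem fun j _ ↦ Submodule.smul_mem _ _ (Submodule.subset_span ⟨j, rfl⟩))

theorem mem_span_pow_iff {A B : Type*} [CommRing A] [Nontrivial A] [Ring B] [Algebra A B] (x : B)
    (n : ℕ) (z : B) : z ∈ Submodule.span A ((fun i ↦ x ^ i) '' Set.Iio n) ↔
      ∃ q : A[X], q.degree < n ∧ aeval x q = z := by
  constructor
  · intro hz
    induction hz using Submodule.span_induction with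
    | mem z hz =>
      obtain ⟨i, hi, rfl⟩ := hz
      exact ⟨X ^ i, by rw [degree_X_pow]; exact_mod_cast hi, by simp⟩
    | zero => exact ⟨0, by rw [degree_zero]; exact WithBot.bot_lt_coe n, map_zero _⟩
    | add y z _ _ hy hz =>
      obtain ⟨p, hp, rfl⟩ := hy
      obtain ⟨q, hq, rfl⟩ := hz
      exact ⟨p + q, (degree_add_le p q).trans_lt (max_lt hp hq), map_add _ _ _⟩
    | smul a z _ hz =>
      obtain ⟨q, hq, rfl⟩ := hz
      exact ⟨a • q, (degree_smul_le a q).trans_lt hq, map_smul _ _ _⟩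
  · rintro ⟨q, hq, rfl⟩
    rcases eq_or_ne q 0 with rfl | h0
    · rw [map_zero]
      exact zero_mem _
    · rw [aeval_eq_sum_range' ((natDegree_lt_iff_degree_lt h0).mpr hq)]
      exact sum_mem fun i hi ↦ Submodule.smul_mem _ _
        (Submodule.subset_span ⟨i, Finset.mem_range.mp hi, rfl⟩)

theorem adjoin_singleton_eq_span_pow {A B : Type*} [CommRing A] [Nontrivial A] [Ring B]
    [Algebra A B] (x : B) {p : A[X]} (hp : p.Monic) (hx : aeval x p = 0) :
    Subalgebra.toSubmodule (Algebra.adjoin A {x}) =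
      Submodule.span A ((fun i ↦ x ^ i) '' Set.Iio p.natDegree) := by
  ext z
  rw [mem_span_pow_iff, Subalgebra.mem_toSubmodule, Algebra.adjoin_singleton_eq_range_aeval,
    AlgHom.mem_range]
  constructor
  · rintro ⟨q, rfl⟩
    refine ⟨q %ₘ p, ?_, ?_⟩
    · rw [← degree_eq_natDegree hp.ne_zero]
      exact degree_modByMonic_lt q hp
    · conv_rhs => rw [← modByMonic_add_div q p, map_add, map_mul, hx, zero_mul, add_zero]
  · rintro ⟨q, _, rfl⟩
    exact ⟨q, rfl⟩

theorem finrank_adjoin_singleton_le {F B : Type*} [Field F] [Ring B] [Algebra F B] (x : B)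
    {p : F[X]} (hp : p ≠ 0) (hx : aeval x p = 0) :
    Module.finrank F (Algebra.adjoin F {x}) ≤ p.natDegree := by
  have hm := monic_mul_leadingCoeff_inv hp
  have h := adjoin_singleton_eq_span_pow x hm (by rw [map_mul, hx, zero_mul])
  rw [natDegree_mul_leadingCoeff_inv p hp] at h
  change Module.finrank F (Subalgebra.toSubmodule (Algebra.adjoin F {x})) ≤ _
  have himage : (fun i ↦ x ^ i) '' Set.Iio p.natDegree =
      Set.range fun i : Fin p.natDegree ↦ x ^ (i : ℕ) := by
    ext z
    exact ⟨fun ⟨i, hi, hz⟩ ↦ ⟨⟨i, hi⟩, hz⟩, fun ⟨i, hz⟩ ↦ ⟨i, i.2, hz⟩⟩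
  rw [h, himage]
  exact (finrank_range_le_card _).trans_eq (Fintype.card_fin _)

/-! ### The order A[π] inside the endomorphism ring. -/

namespace DrinfeldModule

variable {Fq : Type*} {k : Type*} [Field Fq] [Finite Fq] [Field k] [Finite k] [Algebra Fq k]
  {γ : Fq[X] →ₐ[Fq] k} {r : ℕ} (φ : DrinfeldModule γ r)

/-- A nonzero a with φ_a = 0 would annihilate the endomorphism ring, so its tensor product with F
would vanish, against r ≥ 1. -/
theorem injective_of_finrank_frobField (hK : Module.finrank (RatFunc Fq) φ.frobField = r) :
    Function.Injective φ.toRingHom := by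
  rw [injective_iff_map_eq_zero]
  intro a ha
  by_contra h0
  have h1 : (1 : φ.endAlgebra) = 0 := by
    have h2 : a • (1 : φ.endRing) = 0 := Subtype.ext (by
      change φ.toRingHom a * 1 = 0
      rw [ha, zero_mul])
    have h3 : algebraMap Fq[X] (RatFunc Fq) a ≠ 0 := RatFunc.algebraMap_ne_zero h0
    rw [Algebra.TensorProduct.one_def, ← mul_inv_cancel₀ h3, ← Algebra.smul_def,
      TensorProduct.smul_tmul, h2, TensorProduct.tmul_zero]
  have := subsingleton_of_zero_eq_one h1.symm
  have h2 : Module.finrank (RatFunc Fq) φ.frobField = 0 := Module.finrank_zero_of_subsingleton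
  have := φ.rank_pos
  omega

/-- A relation would be a nonzero polynomial over F of degree less than r killing 1 ⊗ π, forcing
[F(π) : F] < r. -/
theorem linearIndependent_frob_pow (hK : Module.finrank (RatFunc Fq) φ.frobField = r) :
    LinearIndependent Fq[X] fun i : Fin r ↦ φ.frob ^ (i : ℕ) := by
  rw [Fintype.linearIndependent_iff]
  intro g hg
  by_contra! hne
  obtain ⟨i, hi⟩ := hne
  let p : (RatFunc Fq)[X] := ∑ i : Fin r, Polynomial.monomial (i : ℕ) (algebraMap Fq[X] (RatFunc Fq) (g i))
  have hp : p ≠ 0 := fun h ↦ by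
    have h1 := congrArg (fun f ↦ Polynomial.coeff f (i : ℕ)) h
    simp only [p, finsetSum_coeff, Polynomial.coeff_monomial, Polynomial.coeff_zero] at h1
    rw [Finset.sum_eq_single i (fun j _ hj ↦ if_neg fun h ↦ hj (Fin.ext h)) (by simp),
      if_pos rfl] at h1
    exact RatFunc.algebraMap_ne_zero hi h1
  have hdeg : p.natDegree < r := by
    rw [natDegree_lt_iff_degree_lt hp]
    simpa only [p, C_mul_X_pow_eq_monomial] using
      degree_sum_fin_lt fun i ↦ algebraMap Fq[X] (RatFunc Fq) (g i)
  have hx : aeval (1 ⊗ₜ[Fq[X]] φ.frob : φ.endAlgebra) p = 0 := by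
    have h1 := congrArg (fun z ↦ (1 : RatFunc Fq) ⊗ₜ[Fq[X]] z) hg
    simp only [TensorProduct.tmul_zero, TensorProduct.tmul_sum] at h1
    rw [← h1, map_sum]
    refine Finset.sum_congr rfl fun j _ ↦ ?_
    rw [aeval_monomial, Algebra.TensorProduct.tmul_pow, one_pow, ← TensorProduct.smul_tmul,
      ← Algebra.smul_def, TensorProduct.smul_tmul', algebraMap_smul]
  have := (finrank_adjoin_singleton_le _ hp hx)
  rw [← hK] at hdeg
  exact absurd hdeg (not_lt.mpr this)

/-- The structure of `A[π] ⊆ End_k(φ)` when `A[π]` is of full rank `r` over `A`. -/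
theorem exists_basis_endRing (hK : Module.finrank (RatFunc Fq) φ.frobField = r) :
    ∃ (b : Module.Basis (Fin r) Fq[X] φ.endRing) (d : ℕ → Fq[X]),
      (∀ i < r, d i ≠ 0) ∧ (∀ i j, i ≤ j → j < r → d i ∣ d j) ∧ IsUnit (d 0) ∧
      (∀ u, u ∈ Subalgebra.toSubmodule φ.frobOrder ↔ ∀ i : Fin r, d i ∣ b.repr u i) ∧
      ∀ i : Fin r, (∃ f : Fq[X][X], f.Monic ∧ f.natDegree = (i : ℕ) ∧ aeval φ.frob f = d i • b i) ∧
        ∀ g : Fq[X][X], g.Monic → g.natDegree = (i : ℕ) → ∀ (c : Fq[X]) (u : φ.endRing),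
          aeval φ.frob g = c • u → c ∣ d i := by
  have hinj := φ.injective_of_finrank_frobField hK
  have hπ := φ.linearIndependent_frob_pow hK
  have hr := φ.rank_pos
  have := φ.isTorsionFree_endRing hinj
  have hrank : Module.finrank Fq[X] φ.endRing = r := le_antisymm (φ.finrank_endRing_le hinj hπ) (by
    simpa using hπ.fintype_card_le_finrank)
  obtain ⟨b, d, hd0, hdvd, htri, hmax⟩ := exists_triangular_basis (v := fun i ↦ φ.frob ^ i)
    (LinearMap.mulLeft Fq[X] φ.frob) (fun i ↦ pow_succ' _ _) hπ
    (exists_smul_mem_span_of_finrank_le hπ hrank.le)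
  -- By Cayley–Hamilton, π is a root of a monic polynomial over A whose degree is the rank r. Hence
  -- A[π] is spanned by 1, …, π^(r-1), with no denominators.
  have hchar : aeval φ.frob (LinearMap.charpoly (LinearMap.mulLeft Fq[X] φ.frob)) = 0 := by
    have h := LinearMap.congr_fun (LinearMap.aeval_self_charpoly (LinearMap.mulLeft Fq[X] φ.frob)) 1
    have h2 : LinearMap.mulLeft Fq[X] φ.frob = Algebra.lmul Fq[X] φ.endRing φ.frob := rfl
    rw [h2, aeval_algHom_apply] at h
    exact (mul_one _).symm.trans h
  have horder := adjoin_singleton_eq_span_pow φ.frob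
    (LinearMap.charpoly_monic (LinearMap.mulLeft Fq[X] φ.frob)) hchar
  rw [LinearMap.charpoly_natDegree, hrank] at horder
  refine ⟨b, d, hd0, hdvd, ?_, fun u ↦ ?_, fun i ↦ ⟨?_, fun g hg hgi c u hu ↦ ?_⟩⟩
  · have h := htri ⟨0, hr⟩
    have hempty : Set.Iio (((⟨0, hr⟩ : Fin r) : ℕ)) = ∅ := by simp
    rw [hempty, Set.image_empty, Submodule.span_empty, Submodule.mem_bot, sub_eq_zero, pow_zero] at h
    -- Since `d 0 • b 0 = 1`, we have `b 0 = d 0 • (b 0 * b 0)`; the coordinate at `b 0` exhibits an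
    -- inverse of `d 0`.
    have h1 : b ⟨0, hr⟩ = d 0 • (b ⟨0, hr⟩ * b ⟨0, hr⟩) := by
      rw [← smul_mul_assoc, h, one_mul]
    have h2 := congrArg (fun z ↦ b.repr z ⟨0, hr⟩) h1
    simp only [map_smul, Module.Basis.repr_self, Finsupp.single_eq_same, Finsupp.smul_apply,
      smul_eq_mul] at h2
    exact .of_mul_eq_one _ h2.symm
  · rw [← mem_span_iff_of_triangular b d htri, frobOrder, horder]
    have himage : (fun i ↦ φ.frob ^ i) '' Set.Iio r =
        Set.range fun i : Fin r ↦ φ.frob ^ (i : ℕ) := by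
      ext z
      exact ⟨fun ⟨i, hi, hz⟩ ↦ ⟨⟨i, hi⟩, hz⟩, fun ⟨i, hz⟩ ↦ ⟨i, i.2, hz⟩⟩
    rw [himage]
  · obtain ⟨q, hq, hqz⟩ := (mem_span_pow_iff _ _ _).mp (htri i)
    refine ⟨X ^ (i : ℕ) + q, monic_X_pow_add hq, ?_, ?_⟩
    · rw [natDegree_add_eq_left_of_degree_lt, natDegree_X_pow]
      rwa [degree_X_pow]
    · rw [map_add, map_pow, aeval_X, hqz, add_sub_cancel]
  · refine hmax i c u ?_
    rw [← hu, mem_span_pow_iff]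
    refine ⟨g - X ^ (i : ℕ), ?_, by rw [map_sub, map_pow, aeval_X]⟩
    have hdeg : g.degree = ((i : ℕ) : WithBot ℕ) := by
      rw [degree_eq_natDegree hg.ne_zero, hgi]
    rw [← hdeg]
    refine degree_sub_lt_left (by rw [hdeg, degree_X_pow]) hg.ne_zero ?_
    rw [hg.leadingCoeff, leadingCoeff_X_pow]

theorem IsFrobeniusIndex.eq {φ : DrinfeldModule γ r} {b b' : Fin (r - 1) → Fq[X]}
    (h : φ.IsFrobeniusIndex b) (h' : φ.IsFrobeniusIndex b') : b = b' := by
  obtain ⟨e⟩ := h.equiv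
  obtain ⟨e'⟩ := h'.equiv
  funext i
  exact eq_of_monic_of_associated (h.monic i) (h'.monic i) (associated_of_dvd_dvd
    (dvd_of_surjective_pi_quotient h.dvd h'.dvd _ (e'.symm.trans e).surjective i)
    (dvd_of_surjective_pi_quotient h'.dvd h.dvd _ (e.symm.trans e').surjective i))

end DrinfeldModule

/-- The Frobenius index `(b₁, …, b_{r-1})` exists and is unique. For `1 ≤ i ≤ r - 1` there is a monic
`f_i ∈ A[x]` of degree `i` with `f_i(π) ∈ b_i End_k(φ)`, and if `g ∈ A[x]` is monic of degree `i` and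
`b ∈ A` is such that `g(π) ∈ b End_k(φ)`, then `b ∣ b_i`. -/
theorem theorem1p1 {Fq : Type u} {k : Type v} [Field Fq] [Finite Fq] [Field k] [Finite k]
    [Algebra Fq k] (γ : Fq[X] →ₐ[Fq] k) (r : ℕ) (φ : DrinfeldModule γ r)
    (hK : Module.finrank (RatFunc Fq) φ.frobField = r) :
    (∃! b : Fin (r - 1) → Fq[X], φ.IsFrobeniusIndex b) ∧
    ∀ b : Fin (r - 1) → Fq[X], φ.IsFrobeniusIndex b →
      ∀ i : Fin (r - 1),
        (∃ f : Fq[X][X], f.Monic ∧ f.natDegree = (i : ℕ) + 1 ∧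
          ∃ u : φ.endRing, aeval φ.frob f = b i • u) ∧
        (∀ g : Fq[X][X], g.Monic → g.natDegree = (i : ℕ) + 1 →
          ∀ c : Fq[X], (∃ u : φ.endRing, aeval φ.frob g = c • u) → c ∣ b i) := by
  classical
  obtain ⟨w, d, hd0, hdvd, hunit, hmem, hpoly⟩ := φ.exists_basis_endRing hK
  -- The unit `d 0` contributes a trivial factor and is dropped, so entry i of the tuple comes from
  -- `d (i + 1)`, made monic.
  let s : Fin (r - 1) → Fin r := fun i ↦ ⟨i + 1, by omega⟩
  let b : Fin (r - 1) → Fq[X] := fun i ↦ normalize (d (s i))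
  have hb : φ.IsFrobeniusIndex b := by
    refine ⟨fun i ↦ monic_normalize (hd0 _ (s i).2), fun i j hij ↦ ?_, ?_⟩
    · exact normalize_dvd_iff.mpr (dvd_normalize_iff.mpr (hdvd _ _ (Nat.succ_le_succ hij) (s j).2))
    · let Ψ : φ.endRing →ₗ[Fq[X]] ((i : Fin (r - 1)) → Fq[X] ⧸ Ideal.span {b i}) :=
        LinearMap.pi fun i ↦ (Ideal.span {b i}).mkQ ∘ₗ w.coord (s i)
      have hker : Subalgebra.toSubmodule φ.frobOrder = LinearMap.ker Ψ := by
        ext u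
        have h1 : u ∈ LinearMap.ker Ψ ↔ ∀ i, d (s i) ∣ w.repr u (s i) := by
          rw [LinearMap.mem_ker, funext_iff]
          refine forall_congr' fun i ↦ ?_
          rw [← normalize_dvd_iff, ← Ideal.mem_span_singleton]
          exact Submodule.Quotient.mk_eq_zero _
        rw [hmem, h1]
        refine ⟨fun h i ↦ h (s i), fun h i ↦ ?_⟩
        obtain ⟨i, hi⟩ := i
        rcases i with _ | i
        · exact hunit.dvd
        · exact h ⟨i, by omega⟩
      have hsurj : Function.Surjective Ψ := by
        intro y
        choose z hz using fun i ↦ Submodule.mkQ_surjective (Ideal.span {b i}) (y i)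
        refine ⟨∑ i, z i • w (s i), funext fun i ↦ ?_⟩
        have hs : Function.Injective s := fun i j h ↦ Fin.ext (by
          simpa [s] using congrArg Fin.val h)
        have h1 : w.coord (s i) (∑ i, z i • w (s i)) = z i := by
          rw [map_sum, Finset.sum_eq_single i]
          · simp
          · intro j _ hj
            simp [hs.ne hj]
          · simp
        rw [← hz, ← h1]
        rfl
      exact ⟨(Submodule.quotEquivOfEq _ _ hker).trans (Ψ.quotKerEquivOfSurjective hsurj)⟩
  refine ⟨⟨b, hb, fun b' hb' ↦ hb'.eq hb⟩, fun b' hb' i ↦ ?_⟩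
  rw [hb'.eq hb]
  obtain ⟨⟨f, hf, hfi, hfw⟩, hg⟩ := hpoly (s i)
  constructor
  · obtain ⟨t, ht⟩ : b i ∣ d (s i) := normalize_dvd_iff.mpr dvd_rfl
    exact ⟨f, hf, hfi, t • w (s i), by rw [hfw, ← mul_smul, ← ht]⟩
  · rintro g hgm hgi c ⟨u, hu⟩
    exact dvd_normalize_iff.mpr (hg g hgm hgi c u hu)
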